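/- Let $\mathbb T$ be the unit circle in $\mathbb C$. For $x,y\in\mathbb T$ write $y\leftarrow x$ (there is an arc from $x$ to $y$) iff $0<\arg(y/x)<\pi$. Let $S=\{e^{iq}:q\in\mathbb Q\}$ be the set of points of $\mathbb T$ with rational argument. The dense local order $\mathbf S(2)$ is the tournament $(S,\leftarrow)$. Let $G=\mathrm{Aut}(\mathbf S(2))$, with the topology of pointwise convergence ($S$ being discrete). Let $P_0^*$ (respectively $P_1^*$) be the set of the points of $S$ in the right (respectively left) open half plane, and let $X^*=\overline{G\cdot(P_0^*,P_1^*)}$ be the closure of the orbit of $(P_0^*,P_1^*)$ in the compact space $\{0,1\}^{S}\times\{0,1\}^{S}$ of pairs of subsets of $S$, on which $G$ acts by $g\cdot(T_0,T_1)=(g(T_0),g(T_1))$. Let $D=S\cup(-S)$ and let $\hat{\mathbb T}=(\mathbb T\setminus D)\cup(D\times\{0,1\})$ be the circle in which the points of $D$ are doubled, with natural projection $p:\hat{\mathbb T}\to\mathbb T$. For $\alpha,\beta\in D$ with $\alpha\leftarrow\beta$ put $$[\alpha,\beta]=\{(\alpha,0)\}\cup\{t\in\hat{\mathbb T}:\alpha\leftarrow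 p(t)\leftarrow\beta\}\cup\{(\beta,1)\}.$$ Then the following hold. 1. $G\curvearrowright X^*$ is the universal minimal flow of $G$: the space $X^*$ is nonempty, compact and Hausdorff, the action of $G$ on it is continuous, every orbit is dense, and for every nonempty compact Hausdorff minimal $G$-flow $Y$ there is a continuous $G$-equivariant map from $X^*$ onto $Y$. 2. The sets $[\alpha,\beta]$, for $\alpha,\beta\in D$ with $\alpha\leftarrow\beta$, form a basis of open sets for a topology on $\hat{\mathbb T}$. 3. With this topology, $\hat{\mathbb T}$ is homeomorphic to $X^*$. More precisely, a homeomorphism $\hat{\mathbb T}\to X^*$ is given by $t\mapsto(T_0,T_1)$, where for $x\in S$: if $x\neq\pm p(t)$, then $x\in T_0$ iff $x\leftarrow p(t)$, and $x\in T_1$ iff $p(t)\leftarrow x$; if $x=p(t)$, then $x$ belongs only to $T_0$ when $t=(x,0)$ and only to $T_1$ when $t=(x,1)$; if $x=-p(t)$, then $x$ belongs only to $T_0$ when $t=(-x,1)$ and only to $T_1$ when $t=(-x,0)$. 4. In particular $X^*$ is homeomorphic to the Cantor space $\{0,1\}^{\mathbb N}$. -/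

import Mathlib

open scoped Pointwise Topology

universe u v w

/-! ## Flows of topological groups -/

/-- `X` is the universal minimal flow of the topological group `G`: a nonempty compact Hausdorff
`G`-flow (the action is jointly continuous) that is minimal (all orbits are dense) and such that
every nonempty compact Hausdorff minimal `G`-flow `Y` is a factor of `X`, that is, the image of `X`
under a continuous, onto, `G`-equivariant map. The flows `Y` range over an arbitrary universe. -/
structure IsUniversalMinimalFlow (G : Type v) [Group G] [TopologicalSpace G] [IsTopologicalGroup G]
    (X : Type w) [TopologicalSpace X] [MulAction G X] : Prop where
  nonempty : Nonempty X
  compactSpace : CompactSpace X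
  t2Space : T2Space X
  continuousSMul : ContinuousSMul G X
  isMinimal : MulAction.IsMinimal G X
  universal : ∀ (Y : Type u) [TopologicalSpace Y] [CompactSpace Y] [T2Space Y] [Nonempty Y]
    [MulAction G Y] [ContinuousSMul G Y] [MulAction.IsMinimal G Y],
    ∃ f : X → Y, Continuous f ∧ Function.Surjective f ∧ ∀ (g : G) (x : X), f (g • x) = g • f x

namespace DenseLocalOrder

/-! ## The tournament `S(2)` -/

/-- The arc relation on the unit circle: there is an arc from `x` to `y`
(written `y ← x`) iff `0 < arg (y / x) < π`. -/
def Arc (x y : Circle) : Prop :=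
  0 < Complex.arg ((y / x : Circle) : ℂ) ∧ Complex.arg ((y / x : Circle) : ℂ) < Real.pi

/-- The set `S` of the points of the unit circle with rational argument
(in radians, `z = exp (i q)` with `q` rational). -/
def S : Set Circle := {z | ∃ q : ℚ, Circle.exp (q : ℝ) = z}

/-- The vertex set of the dense local order `S(2)`. It is a type of its own, so that it
does not carry the topology of the circle: as the universe of a countable structure it is
discrete. -/
def S2 : Type := S

/-- A vertex of `S(2)` as a point of the circle. -/
def S2.pt (x : S2) : Circle := x.1

lemma S2.pt_mem (x : S2) : x.pt ∈ S := x.2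

instance : TopologicalSpace S2 := ⊥

instance : DiscreteTopology S2 := ⟨rfl⟩

/-- The arc relation of `S(2)`, as an induced substructure of the circle. -/
def S2.arc (x y : S2) : Prop := Arc x.pt y.pt

/-- The group `Aut(S(2))`. -/
abbrev AutS2 : Type := S2.arc ≃r S2.arc

/-- The topology of pointwise convergence on `Aut(S(2))`, with `S(2)` discrete. -/
instance : TopologicalSpace AutS2 :=
  TopologicalSpace.induced (fun (g : AutS2) (x : S2) => g x) inferInstance

lemma continuous_eval (x : S2) : Continuous fun g : AutS2 => g x :=
  (continuous_apply x).comp continuous_induced_dom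

lemma continuous_inv_eval (x : S2) : Continuous fun g : AutS2 => g⁻¹ x := by
  refine continuous_discrete_rng.2 fun y => ?_
  have h : (fun g : AutS2 => g⁻¹ x) ⁻¹' {y} = (fun g : AutS2 => g y) ⁻¹' {x} := by
    ext g
    simp only [Set.mem_preimage, Set.mem_singleton_iff]
    constructor
    · rintro rfl
      exact RelIso.apply_inv_self g x
    · rintro rfl
      exact RelIso.inv_apply_self g y
  rw [h]
  exact (isOpen_discrete {x}).preimage (continuous_eval y)

instance : IsTopologicalGroup AutS2 where
  continuous_mul := by
    refine continuous_induced_rng.2 (continuous_pi fun x => continuous_discrete_rng.2 fun y => ?_)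
    refine isOpen_iff_mem_nhds.2 ?_
    rintro ⟨g, h⟩ hgh
    have h1 : (fun k : AutS2 => k x) ⁻¹' {h x} ∈ 𝓝 h :=
      ((isOpen_discrete {h x}).preimage (continuous_eval x)).mem_nhds rfl
    have h2 : (fun k : AutS2 => k (h x)) ⁻¹' {g (h x)} ∈ 𝓝 g :=
      ((isOpen_discrete {g (h x)}).preimage (continuous_eval (h x))).mem_nhds rfl
    filter_upwards [prod_mem_nhds h2 h1]
    rintro ⟨g', h'⟩ ⟨hg, hh⟩
    simp only [Set.mem_preimage, Set.mem_singleton_iff] at hg hh hgh ⊢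
    change g' (h' x) = y
    change g (h x) = y at hgh
    rw [hh, hg, hgh]
  continuous_inv :=
    continuous_induced_rng.2 (continuous_pi fun x => continuous_inv_eval x)

/-! ## The flow `X*` -/

/-- The compact space `[2]^{S(2)} × [2]^{S(2)}` of all pairs of unary relations on `S(2)`
(product topology, `Bool` discrete). -/
def UnaryPairs : Type := (S2 → Bool) × (S2 → Bool)

instance : TopologicalSpace UnaryPairs :=
  inferInstanceAs (TopologicalSpace ((S2 → Bool) × (S2 → Bool)))

/-- The logic action: `(g • T) x ↔ T (g⁻¹ x)`, on each of the two relations. -/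
instance : MulAction AutS2 UnaryPairs where
  smul g T := (fun x => T.1 (g⁻¹ x), fun x => T.2 (g⁻¹ x))
  one_smul _ := rfl
  mul_smul _ _ _ := rfl

lemma continuous_smul_unaryPairs (g : AutS2) : Continuous fun T : UnaryPairs => g • T :=
  Continuous.prodMk
    (continuous_pi fun x => (continuous_apply (g⁻¹ x)).comp continuous_fst)
    (continuous_pi fun x => (continuous_apply (g⁻¹ x)).comp continuous_snd)

open Classical in
/-- The pair `(P₀*, P₁*)`: `P₀*` is the part of `S(2)` in the right half plane, and `P₁*` is the
part in the left half plane. -/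
noncomputable def halfPlanes : UnaryPairs :=
  (fun x => decide (0 < (x.pt : ℂ).re), fun x => decide ((x.pt : ℂ).re < 0))

/-- The flow `X*`: the closure of the `Aut(S(2))`-orbit of `(P₀*, P₁*)`, with the restricted
action. Its coercion to a type carries the subspace topology. -/
noncomputable def Xstar : SubMulAction AutS2 UnaryPairs where
  carrier := closure (MulAction.orbit AutS2 halfPlanes)
  smul_mem' g _ hT := by
    refine map_mem_closure (continuous_smul_unaryPairs g) hT ?_
    intro U hU
    exact MulAction.mem_orbit_of_mem_orbit g hU

/-! ## The circle with the points of `S ∪ (-S)` doubled -/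

/-- The set `S ∪ (-S)`. -/
def D : Set Circle := S ∪ -S

/-- The set `C ∪ (S ∪ (-S)) × [2]`, where `C` is the complement of `S ∪ (-S)` in the circle. -/
def That : Type := {z : Circle // z ∉ D} ⊕ (D × Fin 2)

namespace That

/-- The copy `(d, i)` of a doubled point. -/
def dbl (d : D) (i : Fin 2) : That := Sum.inr (d, i)

/-- The natural projection to the circle. -/
def proj : That → Circle := Sum.elim (fun z => z.1) (fun e => e.1.1)

/-- The set `[α, β]`, used when `α ← β`: it consists of `(α, 0)`, of the points `t` with
`α ← proj t ← β`, and of `(β, 1)`. -/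
def interval (α β : D) : Set That :=
  {dbl α 0} ∪ {t | Arc (proj t) α ∧ Arc β (proj t)} ∪ {dbl β 1}

/-- The family of all the sets `[α, β]` with `α, β ∈ S ∪ (-S)` and `α ← β`. -/
def intervals : Set (Set That) := {I | ∃ α β : D, Arc β α ∧ I = interval α β}

/-- The topology generated by the sets `[α, β]`. -/
instance : TopologicalSpace That := TopologicalSpace.generateFrom intervals

end That

/-- A vertex of `S(2)` as an element of `S ∪ (-S)`. -/
def S2.toD (x : S2) : D := ⟨x.pt, Or.inl x.pt_mem⟩

/-- The antipode of a vertex of `S(2)` as an element of `S ∪ (-S)`. -/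
noncomputable def S2.antipode (x : S2) : D := ⟨-x.pt, Or.inr (by rw [Set.mem_neg, neg_neg]; exact x.pt_mem)⟩

open Classical in
/-- The pair `(T₀, T₁)` of half circles of `S(2)` that is coded by `t`: a vertex `x` other than
`± proj t` is in `T₀` iff `x ← proj t`, and in `T₁` iff `proj t ← x` (so `proj t` is the supremum
of `T₀` with respect to `←`). If `x = proj t`, then `x` is in `T₀` when `t = (x, 0)` and in `T₁`
when `t = (x, 1)`; if `x = - proj t`, then `x` is in `T₀` when `t = (-x, 1)` and in `T₁` when
`t = (-x, 0)`. -/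
noncomputable def halves (t : That) : UnaryPairs :=
  (fun x => decide (Arc t.proj x.pt ∨ t = That.dbl x.toD 0 ∨ t = That.dbl x.antipode 1),
   fun x => decide (Arc x.pt t.proj ∨ t = That.dbl x.toD 1 ∨ t = That.dbl x.antipode 0))

end DenseLocalOrder

/-! Replace every vertex in the left half plane by its antipode. Antipodes reverse arcs, so the
tournament turns into the linear order of slopes, in which each half plane is a dense colour class
(`arc_iff_slope`, `exists_slope_between`). The stabilizer of `halfPlanes` is thus the automorphism
group of a countable dense order with two dense colours.

Universality: by Ramsey's theorem the stabilizer fixes a point `y` in every nonempty compact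
Hausdorff flow (`exists_forall_smul_near`, `exists_fixed_by_stabilizer`). The orbit closure of
`(basePoint, y)` in the product is the graph of a map: back-and-forth (`exists_equiv_extending`)
shows that two group elements whose images of the half planes agree on a finite set differ, up to
the stabilizer, by an element fixing that set (`eq_of_mem_closure_range`). If the target is minimal,
the map is onto.

Geometry: call a partition a cut if reversing the arcs between its parts gives a transitive
relation. A cut selects one point of each antipodal pair of `D`, transitively, and a supremum
argument shows that such selections are exactly the half circles ending at a point of the doubled
circle (`That.exists_mem_half_iff`). Cuts form a closed invariant set, and rotations make every
orbit in it dense. Hence this set is `Xstar`, it is minimal, and it is homeomorphic to the doubled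
circle. Countably many clopen conditions separate its points and no point is isolated, so it is a
Cantor space. -/

/-! ## Brouwer's characterization of the Cantor space -/

section Cantor

variable {X : Type*} [TopologicalSpace X]

/-- In a space in which nonempty open sets have at least two points, separated by the clopen sets
`U n`, every nonempty clopen set is cut in two by a clopen set, which can be required
to be `U n` if this is possible. -/
lemma exists_isClopen_split {U : ℕ → Set X} (hU : ∀ n, IsClopen (U n))
    (hsep : ∀ x y, (∀ n, x ∈ U n ↔ y ∈ U n) → x = y)
    (hperf : ∀ V : Set X, IsOpen V → V.Nonempty → V.Nontrivial)
    (n : ℕ) {C : Set X} (hC : IsClopen C) (hne : C.Nonempty) :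
    ∃ W, IsClopen W ∧ (C ∩ W).Nonempty ∧ (C \ W).Nonempty ∧
      ((C ∩ W ⊆ U n ∨ Disjoint (C ∩ W) (U n)) ∧ (C \ W ⊆ U n ∨ Disjoint (C \ W) (U n))) := by
  by_cases h : (C ∩ U n).Nonempty ∧ (C \ U n).Nonempty
  · exact ⟨U n, hU n, h.1, h.2, Or.inl Set.inter_subset_right, Or.inr Set.disjoint_sdiff_left⟩
  · have hCU : C ⊆ U n ∨ Disjoint C (U n) := by
      rw [Set.disjoint_iff_inter_eq_empty, ← Set.sdiff_eq_empty, ← Set.not_nonempty_iff_eq_empty,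
        ← Set.not_nonempty_iff_eq_empty]
      tauto
    -- Here `U n` does not cut `C`. Any `U m` separating two points of `C` serves, as both pieces
    -- inherit the position of `C` relative to `U n`.
    obtain ⟨x, hx, y, hy, hxy⟩ := hperf C hC.isOpen hne
    obtain ⟨m, hm⟩ : ∃ m, ¬ (x ∈ U m ↔ y ∈ U m) := by
      by_contra! h'
      exact hxy (hsep x y h')
    have hW : (C ∩ U m).Nonempty ∧ (C \ U m).Nonempty := by
      by_cases hxm : x ∈ U m
      · exact ⟨⟨x, hx, hxm⟩, ⟨y, hy, fun h => hm (iff_of_true hxm h)⟩⟩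
      · exact ⟨⟨y, hy, by tauto⟩, ⟨x, hx, hxm⟩⟩
    exact ⟨U m, hU m, hW.1, hW.2,
      hCU.imp Set.inter_subset_left.trans (·.mono_left Set.inter_subset_left),
      hCU.imp Set.sdiff_subset.trans (·.mono_left Set.sdiff_subset)⟩

/-- A compact space with a sequence of clopen sets separating its points, and in which nonempty
open sets have at least two points, is homeomorphic to the Cantor space. -/
theorem nonempty_homeomorph_nat_bool [CompactSpace X] [Nonempty X] (U : ℕ → Set X)
    (hU : ∀ n, IsClopen (U n)) (hsep : ∀ x y, (∀ n, x ∈ U n ↔ y ∈ U n) → x = y)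
    (hperf : ∀ V : Set X, IsOpen V → V.Nonempty → V.Nontrivial) : Nonempty (X ≃ₜ (ℕ → Bool)) := by
  classical
  have := fun n (C : {C : Set X // IsClopen C ∧ C.Nonempty}) =>
    exists_isClopen_split hU hsep hperf n C.2.1 C.2.2
  choose W hWc hWi hWd hWU using this
  let next (n : ℕ) (C : {C : Set X // IsClopen C ∧ C.Nonempty}) (b : Bool) :
      {C : Set X // IsClopen C ∧ C.Nonempty} :=
    if b then ⟨C.1 ∩ W n C, C.2.1.inter (hWc n C), hWi n C⟩
    else ⟨C.1 \ W n C, C.2.1.diff (hWc n C), hWd n C⟩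
  -- The node reached after `n` bits of `f` in a binary tree of clopen sets. Stage `n + 1` is
  -- decided by `U n`, so each branch shrinks to a single point.
  let cell (f : ℕ → Bool) (n : ℕ) : {C : Set X // IsClopen C ∧ C.Nonempty} :=
    Nat.rec ⟨Set.univ, isClopen_univ, Set.univ_nonempty⟩ (fun n C => next n C (f n)) n
  have cell_succ : ∀ f n, cell f (n + 1) = next n (cell f n) (f n) := fun f n => rfl
  have mem_next : ∀ n C b x, x ∈ (next n C b).1 ↔ x ∈ C.1 ∧ (x ∈ W n C ↔ b = true) := by
    intro n C b x
    cases b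
    · simp [next]
    · simp [next]
  have cell_congr : ∀ f g n, (∀ i < n, f i = g i) → cell f n = cell g n := by
    intro f g n
    induction n with
    | zero => intro _; rfl
    | succ n ih =>
      intro h
      rw [cell_succ, cell_succ, ih fun i hi => h i (by omega), h n (by omega)]
  have cell_decides : ∀ f n, (cell f (n + 1)).1 ⊆ U n ∨ Disjoint (cell f (n + 1)).1 (U n) := by
    intro f n
    rw [cell_succ]
    cases hf : f n
    · simpa [next, hf] using (hWU n (cell f n)).2
    · simpa [next, hf] using (hWU n (cell f n)).1
  have cell_anti : ∀ f n, (cell f (n + 1)).1 ⊆ (cell f n).1 := by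
    intro f n x hx
    rw [cell_succ, mem_next] at hx
    exact hx.1
  have hinter : ∀ f, (⋂ n, (cell f n).1).Nonempty := fun f =>
    IsCompact.nonempty_iInter_of_sequence_nonempty_isCompact_isClosed _ (cell_anti f)
      (fun n => (cell f n).2.2) (cell f 0).2.1.isClosed.isCompact (fun n => (cell f n).2.1.isClosed)
  choose ψ hψ using hinter
  have hψ' : ∀ f n, ψ f ∈ (cell f n).1 := fun f n => Set.mem_iInter.1 (hψ f) n
  have mem_U : ∀ f x n, x ∈ (cell f (n + 1)).1 → (x ∈ U n ↔ ψ f ∈ U n) := by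
    intro f x n hx
    rcases cell_decides f n with h | h
    · exact iff_of_true (h hx) (h (hψ' f (n + 1)))
    · exact iff_of_false (Set.disjoint_left.1 h hx) (Set.disjoint_left.1 h (hψ' f (n + 1)))
  let u (x : X) (n : ℕ) : Bool := decide (x ∈ U n)
  have hu : ∀ x n, u x n = true ↔ x ∈ U n := fun x n => decide_eq_true_iff
  have hucont : Continuous u := by
    refine continuous_pi fun n => (continuous_bool_rng true).2 ?_
    convert hU n using 1
    exact Set.ext fun x => hu x n
  have huinj : Function.Injective u := fun x y h => hsep x y fun n => by rw [← hu, ← hu, h]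
  have huemb : Topology.IsEmbedding u := (hucont.isClosedEmbedding huinj).isEmbedding
  have : T2Space X := huemb.t2Space
  have hcont : Continuous ψ := by
    refine huemb.continuous_iff.2 (continuous_pi fun n => continuous_iff_continuousAt.2 fun f => ?_)
    have : ∀ᶠ g in nhds f, ∀ i ∈ Finset.range (n + 1), g i = f i := by
      rw [Filter.eventually_all_finset]
      intro i _
      exact (continuous_apply i).continuousAt.eventually ((isOpen_discrete {f i}).mem_nhds rfl)
    refine (continuousAt_const (y := u (ψ f) n)).congr ?_
    filter_upwards [this] with g hg
    refine Bool.eq_iff_iff.2 ((hu _ _).trans ((mem_U g (ψ f) n ?_).trans (hu _ _).symm))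
    rw [cell_congr g f (n + 1) fun i hi => hg i (Finset.mem_range.2 hi)]
    exact hψ' f (n + 1)
  have hinj : Function.Injective ψ := by
    intro f g hfg
    funext n
    induction n using Nat.strong_induction_on with
    | _ n ih =>
      have hf := hψ' f (n + 1)
      have hg := hψ' g (n + 1)
      rw [cell_succ, mem_next] at hf hg
      rw [← hfg, ← cell_congr f g n ih] at hg
      rw [Bool.eq_iff_iff]
      exact hf.2.symm.trans hg.2
  have hsurj : Function.Surjective ψ := by
    intro x
    let C (n : ℕ) : {C : Set X // IsClopen C ∧ C.Nonempty} :=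
      Nat.rec ⟨Set.univ, isClopen_univ, Set.univ_nonempty⟩
        (fun n C => next n C (decide (x ∈ W n C))) n
    let f (n : ℕ) : Bool := decide (x ∈ W n (C n))
    have hC : ∀ n, cell f n = C n := by
      intro n
      induction n with
      | zero => rfl
      | succ n ih => rw [cell_succ, ih]
    have hx : ∀ n, x ∈ (cell f n).1 := by
      intro n
      induction n with
      | zero => exact Set.mem_univ x
      | succ n ih =>
        rw [cell_succ, mem_next, hC]
        exact ⟨hC n ▸ ih, decide_eq_true_iff.symm⟩
    exact ⟨f, hsep _ _ fun n => (mem_U f x n (hx (n + 1))).symm⟩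
  exact ⟨(Continuous.homeoOfEquivCompactToT2 (f := Equiv.ofBijective ψ ⟨hinj, hsurj⟩) hcont).symm⟩

end Cantor

/-! ## Ramsey's theorem -/

/-- The infinite Ramsey theorem for finite colourings of the `k`-element sets of natural
numbers. -/
theorem exists_strictMono_forall_card_eq {κ : Type*} [Finite κ] (k : ℕ) (c : Finset ℕ → κ) :
    ∃ v : ℕ → ℕ, StrictMono v ∧ ∃ a, ∀ s : Finset ℕ, (↑s ⊆ Set.range v) → s.card = k →
      c s = a := by
  classical
  have lim : ∀ f : ℕ → κ, ∃ a, ∀ᶠ n in (Filter.hyperfilter ℕ : Filter ℕ), f n = a := by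
    intro f
    obtain ⟨a, -, ha⟩ := (Ultrafilter.finite_biUnion_mem_iff (f := Filter.hyperfilter ℕ)
      (is := Set.univ) (s := fun a => {n | f n = a}) Set.finite_univ).1 (by
        exact Filter.univ_mem' fun n => by simp)
    exact ⟨a, ha⟩
  choose L hL using lim
  -- `c' j s` is the iterated ultrafilter limit of the colour of `s` enlarged by `j` further
  -- elements.
  let c' (j : ℕ) : Finset ℕ → κ := Nat.rec c (fun _ d s => L fun n => d (insert n s)) j
  have hc' : ∀ j s, ∀ᶠ n in (Filter.hyperfilter ℕ : Filter ℕ), c' j (insert n s) = c' (j + 1) s :=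
    fun j s => hL fun n => c' j (insert n s)
  have hnext : ∀ N, ∃ n, N < n ∧ ∀ s ∈ (Finset.range (N + 1)).powerset, ∀ j ∈ Finset.range k,
      c' j (insert n s) = c' (j + 1) s := by
    intro N
    refine Filter.Eventually.exists (f := (Filter.hyperfilter ℕ : Filter ℕ)) (.and ?_ ?_)
    · exact Filter.hyperfilter_le_cofinite
        (by simpa [Nat.cofinite_eq_atTop] using Filter.eventually_gt_atTop N)
    · rw [Filter.eventually_all_finset]
      intro s _
      rw [Filter.eventually_all_finset]
      exact fun j _ => hc' j s
  choose next hlt hnext using hnext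
  let w (i : ℕ) : ℕ := next^[i] 0
  have hw : ∀ i, w (i + 1) = next (w i) := fun i => Function.iterate_succ_apply' next i 0
  have hwmono : StrictMono w := strictMono_nat_of_lt_succ fun i => by rw [hw]; exact hlt _
  -- Deleting the maximum of `s` trades one element for one limit, until only `c' k ∅` is left. The
  -- sequence starts at `w 1`, since the maximum has to be a value of `next`.
  have key : ∀ m, m ≤ k → ∀ s : Finset ℕ, (↑s ⊆ Set.range fun i => w (i + 1)) → s.card = m →
      c' (k - m) s = c' k ∅ := by
    intro m
    induction m with
    | zero =>
      intro _ s _ hs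
      rw [Finset.card_eq_zero.1 hs, Nat.sub_zero]
    | succ m ih =>
      intro hm s hsv hs
      have hne : s.Nonempty := Finset.card_pos.1 (by omega)
      obtain ⟨i, hi⟩ := hsv (s.max'_mem hne)
      have hi' : next (w i) = s.max' hne := (hw i).symm.trans hi
      have hsub : s.erase (s.max' hne) ∈ (Finset.range (w i + 1)).powerset := by
        rw [Finset.mem_powerset]
        intro x hx
        obtain ⟨l, hl⟩ := hsv (Finset.mem_of_mem_erase hx)
        have hlx : w (l + 1) < w (i + 1) := by
          rw [show w (l + 1) = x from hl, show w (i + 1) = s.max' hne from hi]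
          exact s.lt_max'_of_mem_erase_max' hne hx
        have : l + 1 ≤ i := Nat.lt_succ_iff.1 (hwmono.lt_iff_lt.1 hlx)
        rw [Finset.mem_range, ← show w (l + 1) = x from hl]
        exact Nat.lt_succ_of_le (hwmono.monotone this)
      have h := hnext (w i) _ hsub (k - (m + 1)) (Finset.mem_range.2 (by omega))
      rw [hi', Finset.insert_erase (s.max'_mem hne),
        show k - (m + 1) + 1 = k - m by omega] at h
      rw [h]
      refine ih (by omega) _ (fun x hx => hsv (Finset.mem_of_mem_erase hx)) ?_
      rw [Finset.card_erase_of_mem (s.max'_mem hne), hs, Nat.add_sub_cancel]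
  refine ⟨fun i => w (i + 1), fun i j h => hwmono (by omega), c' k ∅, fun s hs hk => ?_⟩
  have := key k le_rfl s hs hk
  rwa [Nat.sub_self] at this

/-! ## Homogeneity of dense linear orders with dense colour classes -/

section BackAndForth

variable {α κ : Type*} (ord : α → ℝ) (col : α → κ)

/-- A finite set of pairs preserving order and colours. -/
def IsPartialIso (f : Finset (α × α)) : Prop :=
  ∀ p ∈ f, col p.1 = col p.2 ∧ ∀ q ∈ f, (ord p.1 < ord q.1 ↔ ord p.2 < ord q.2)

variable {ord col}

lemma IsPartialIso.swap [DecidableEq α] {f : Finset (α × α)} (hf : IsPartialIso ord col f) :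
    IsPartialIso ord col (f.image Prod.swap) := by
  intro p hp
  obtain ⟨p, hp', rfl⟩ := Finset.mem_image.1 hp
  refine ⟨(hf p hp').1.symm, fun q hq => ?_⟩
  obtain ⟨q, hq', rfl⟩ := Finset.mem_image.1 hq
  exact ((hf p hp').2 q hq').symm

/-- The partners of the points below `a` lie below the partners of the points above `a`; density of
the colour of `a` supplies a vertex in the gap. -/
lemma IsPartialIso.exists_insert [DecidableEq α] (hord : Function.Injective ord)
    (hdense : ∀ a b, a < b → ∀ c, ∃ x, col x = c ∧ a < ord x ∧ ord x < b)
    {f : Finset (α × α)} (hf : IsPartialIso ord col f) (a : α) :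
    ∃ b, IsPartialIso ord col (insert (a, b) f) := by
  by_cases h : ∃ b, (a, b) ∈ f
  · obtain ⟨b, hb⟩ := h
    exact ⟨b, by rwa [Finset.insert_eq_of_mem hb]⟩
  have hlt : ∀ x ∈ {p ∈ f | ord p.1 < ord a}.image (fun p => ord p.2),
      ∀ y ∈ {p ∈ f | ord a < ord p.1}.image (fun p => ord p.2), x < y := by
    intro x hx y hy
    obtain ⟨p, hp, rfl⟩ := Finset.mem_image.1 hx
    obtain ⟨q, hq, rfl⟩ := Finset.mem_image.1 hy
    rw [Finset.mem_filter] at hp hq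
    exact ((hf p hp.1).2 q hq.1).1 (hp.2.trans hq.2)
  obtain ⟨m, hm, hm'⟩ := Order.exists_between_finsets _ _ hlt
  -- A second separating number opens a genuine interval `(m, m')` to which density applies.
  obtain ⟨m', h1, h2⟩ := Order.exists_between_finsets {m} _
    (fun x hx y hy => by rw [Finset.mem_singleton.1 hx]; exact hm' y hy)
  obtain ⟨b, hb, hmb, hbm⟩ := hdense m m' (h1 m (Finset.mem_singleton_self m)) (col a)
  have hab : ∀ p ∈ f, (ord p.1 < ord a ∧ ord p.2 < ord b) ∨
      (ord a < ord p.1 ∧ ord b < ord p.2) := by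
    intro p hp
    have hne : p.1 ≠ a := fun h' => h ⟨p.2, by rwa [← h']⟩
    rcases lt_or_gt_of_ne (hord.ne hne) with h' | h'
    · exact Or.inl ⟨h', (hm _ (Finset.mem_image.2
        ⟨p, Finset.mem_filter.2 ⟨hp, h'⟩, rfl⟩)).trans hmb⟩
    · exact Or.inr ⟨h', hbm.trans (h2 _ (Finset.mem_image.2
        ⟨p, Finset.mem_filter.2 ⟨hp, h'⟩, rfl⟩))⟩
  refine ⟨b, fun p hp => ?_⟩
  rcases Finset.mem_insert.1 hp with rfl | hp
  · refine ⟨hb.symm, fun q hq => ?_⟩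
    rcases Finset.mem_insert.1 hq with rfl | hq
    · simp
    · rcases hab q hq with h' | h'
      · exact iff_of_false h'.1.not_gt h'.2.not_gt
      · exact iff_of_true h'.1 h'.2
  · refine ⟨(hf p hp).1, fun q hq => ?_⟩
    rcases Finset.mem_insert.1 hq with rfl | hq
    · rcases hab p hp with h' | h'
      · exact iff_of_true h'.1 h'.2
      · exact iff_of_false h'.1.not_gt h'.2.not_gt
    · exact (hf p hp).2 q hq

/-- Every finite partial isomorphism of a countable coloured linear order all of whose colour
classes are dense extends to an automorphism. -/
theorem exists_equiv_extending [Countable α] (hord : Function.Injective ord)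
    (hdense : ∀ a b, a < b → ∀ c, ∃ x, col x = c ∧ a < ord x ∧ ord x < b)
    (A : Finset α) (f : α → α) (hf : ∀ x ∈ A, ∀ y ∈ A, ord x < ord y → ord (f x) < ord (f y))
    (hcol : ∀ x ∈ A, col (f x) = col x) :
    ∃ g : α ≃ α, (∀ x y, ord (g x) < ord (g y) ↔ ord x < ord y) ∧ (∀ x, col (g x) = col x) ∧
      ∀ x ∈ A, g x = f x := by
  classical
  have := Encodable.ofCountable α
  let P := {f : Finset (α × α) // IsPartialIso ord col f}
  let left (a : α) : Order.Cofinal P :=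
    { carrier := {f | ∃ b, (a, b) ∈ f.1}
      isCofinal := fun f => by
        obtain ⟨b, hb⟩ := f.2.exists_insert hord hdense a
        exact ⟨⟨_, hb⟩, ⟨b, Finset.mem_insert_self _ _⟩, Finset.subset_insert _ _⟩ }
  let right (b : α) : Order.Cofinal P :=
    { carrier := {f | ∃ a, (a, b) ∈ f.1}
      isCofinal := fun f => by
        obtain ⟨a, ha⟩ := f.2.swap.exists_insert hord hdense b
        refine ⟨⟨_, ha.swap⟩, ⟨a, Finset.mem_image.2 ⟨(b, a), Finset.mem_insert_self _ _, rfl⟩⟩,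
          fun p hp => Finset.mem_image.2 ⟨p.swap, Finset.mem_insert_of_mem
            (Finset.mem_image_of_mem _ hp), p.swap_swap⟩⟩ }
  let p₀ : P := ⟨A.image fun x => (x, f x), by
    intro p hp
    obtain ⟨x, hx, rfl⟩ := Finset.mem_image.1 hp
    refine ⟨(hcol x hx).symm, fun q hq => ?_⟩
    obtain ⟨y, hy, rfl⟩ := Finset.mem_image.1 hq
    refine ⟨hf x hx y hy, fun h => ?_⟩
    by_contra hxy
    rcases (not_lt.1 hxy).lt_or_eq with h' | h'
    · exact h.asymm (hf y hy x hx h')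
    · obtain rfl : y = x := hord h'
      exact lt_irrefl _ h⟩
  -- A generic ideal meeting countably many requirements: every vertex enters the domain and the
  -- range. Its union is the graph of the automorphism.
  let I := Order.idealOfCofinals p₀ (Sum.elim left right)
  let R (x y : α) : Prop := ∃ f ∈ I, (x, y) ∈ f.1
  have hR : ∀ {x y x' y'}, R x y → R x' y' →
      col x = col y ∧ (ord x < ord x' ↔ ord y < ord y') := by
    rintro x y x' y' ⟨f, hf, hxy⟩ ⟨f', hf', hxy'⟩
    obtain ⟨F, -, h1, h2⟩ := I.directed f hf f' hf'
    exact ⟨(F.2 _ (h1 hxy)).1, (F.2 _ (h1 hxy)).2 _ (h2 hxy')⟩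
  have hleft : ∀ x, ∃ y, R x y := by
    intro x
    obtain ⟨f, ⟨y, hy⟩, hf⟩ :=
      Order.cofinal_meets_idealOfCofinals p₀ (Sum.elim left right) (Sum.inl x)
    exact ⟨y, f, hf, hy⟩
  have hright : ∀ y, ∃ x, R x y := by
    intro y
    obtain ⟨f, ⟨x, hx⟩, hf⟩ :=
      Order.cofinal_meets_idealOfCofinals p₀ (Sum.elim left right) (Sum.inr y)
    exact ⟨x, f, hf, hx⟩
  have hfun : ∀ {x y y'}, R x y → R x y' → y = y' := by
    intro x y y' h h'
    refine hord (le_antisymm (not_lt.1 fun hlt => ?_) (not_lt.1 fun hlt => ?_))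
    · exact lt_irrefl _ ((hR h' h).2.2 hlt)
    · exact lt_irrefl _ ((hR h h').2.2 hlt)
  have hinj : ∀ {x x' y}, R x y → R x' y → x = x' := by
    intro x x' y h h'
    refine hord (le_antisymm (not_lt.1 fun hlt => ?_) (not_lt.1 fun hlt => ?_))
    · exact lt_irrefl _ ((hR h' h).2.1 hlt)
    · exact lt_irrefl _ ((hR h h').2.1 hlt)
  choose F hF using hleft
  choose F' hF' using hright
  refine ⟨⟨F, F', fun x => hinj (hF' _) (hF x), fun y => hfun (hF _) (hF' y)⟩,
    fun x y => (hR (hF x) (hF y)).2.symm, fun x => (hR (hF x) (hF x)).1.symm, fun x hx => ?_⟩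
  exact hfun (hF x) ⟨p₀, Order.mem_idealOfCofinals _ _, Finset.mem_image_of_mem _ hx⟩

end BackAndForth

namespace DenseLocalOrder

/-! ## The arc relation on the circle -/

/-- On the unit circle the imaginary part of `y / x` is the sine of its argument, positive exactly
on `(0, π)`. Arcs become positive determinants, open to polynomial arithmetic. -/
lemma arc_iff (x y : Circle) :
    Arc x y ↔ 0 < (x : ℂ).re * (y : ℂ).im - (x : ℂ).im * (y : ℂ).re := by
  have him : ((y / x : Circle) : ℂ).im
      = (x : ℂ).re * (y : ℂ).im - (x : ℂ).im * (y : ℂ).re := by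
    rw [div_eq_mul_inv, Circle.coe_mul, Circle.coe_inv_eq_conj]
    simp only [Complex.mul_im, Complex.conj_re, Complex.conj_im]
    ring
  rw [← him, Arc]
  set z : ℂ := ((y / x : Circle) : ℂ) with hz
  have hnorm : ‖z‖ = 1 := Circle.norm_coe _
  have hsin : Real.sin z.arg = z.im := by rw [Complex.sin_arg, hnorm, div_one]
  constructor
  · rintro ⟨h0, h1⟩
    rw [← hsin]
    exact Real.sin_pos_of_pos_of_lt_pi h0 h1
  · intro h
    refine ⟨lt_of_le_of_ne (Complex.arg_nonneg_iff.2 h.le) fun h0 => ?_,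
      Complex.arg_lt_pi_iff.2 (Or.inr h.ne')⟩
    rw [← hsin, ← h0, Real.sin_zero] at h
    exact lt_irrefl _ h

lemma arc_neg_right {x y : Circle} : Arc x (-y) ↔ Arc y x := by
  rw [arc_iff, arc_iff]
  simp only [Circle.coe_neg, Complex.neg_re, Complex.neg_im]
  constructor <;> intro h <;> linarith

lemma arc_neg_left {x y : Circle} : Arc (-x) y ↔ Arc y x := by
  rw [arc_iff, arc_iff]
  simp only [Circle.coe_neg, Complex.neg_re, Complex.neg_im]
  constructor <;> intro h <;> linarith

lemma Arc.asymm {x y : Circle} (h : Arc x y) : ¬ Arc y x := by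
  rw [arc_iff] at *
  intro h'
  linarith

lemma arc_irrefl (x : Circle) : ¬ Arc x x := fun h => h.asymm h

lemma Arc.ne {x y : Circle} (h : Arc x y) : x ≠ y := by
  rintro rfl
  exact arc_irrefl _ h

lemma arc_mul_left (z x y : Circle) : Arc (z * x) (z * y) ↔ Arc x y := by
  rw [Arc, Arc, mul_div_mul_left_eq_div]

lemma arc_exp {a b : ℝ} (h : a < b) (h' : b < a + Real.pi) :
    Arc (Circle.exp a) (Circle.exp b) := by
  rw [Arc, ← Circle.exp_sub, Circle.arg_exp (by linarith [Real.pi_pos]) (by linarith)]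
  constructor <;> linarith

lemma Arc.exists_exp {x y : Circle} (h : Arc x y) :
    ∃ a b : ℝ, a < b ∧ b < a + Real.pi ∧ Circle.exp a = x ∧ Circle.exp b = y := by
  refine ⟨Complex.arg x, Complex.arg x + Complex.arg ((y / x : Circle) : ℂ), ?_, ?_, ?_, ?_⟩
  · linarith [h.1]
  · linarith [h.2]
  · exact Circle.exp_arg x
  · rw [Circle.exp_add, Circle.exp_arg, Circle.exp_arg, mul_div_cancel]

lemma arc_total (x y : Circle) : x = y ∨ x = -y ∨ Arc x y ∨ Arc y x := by
  rw [arc_iff, arc_iff]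
  rcases lt_trichotomy 0 ((x : ℂ).re * (y : ℂ).im - (x : ℂ).im * (y : ℂ).re) with h | h | h
  · exact Or.inr (Or.inr (Or.inl h))
  · have hx := Circle.normSq_coe x
    have hy := Circle.normSq_coe y
    rw [Complex.normSq_apply] at hx hy
    set a := (x : ℂ).re with ha
    set b := (x : ℂ).im with hb
    set c := (y : ℂ).re with hc
    set d := (y : ℂ).im with hd
    -- Lagrange's identity: for unit vectors the squares of the inner product and of the determinant
    -- add up to 1.
    have hsq : (a * c + b * d - 1) * (a * c + b * d + 1) = 0 := by
      linear_combination (c * c + d * d) * hx + hy + (a * d - b * c) * h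
    rcases mul_eq_zero.1 hsq with h1 | h1
    · left
      apply Circle.ext
      apply Complex.ext
      · change a = c
        nlinarith [sq_nonneg (a - c), sq_nonneg (b - d)]
      · change b = d
        nlinarith [sq_nonneg (a - c), sq_nonneg (b - d)]
    · right; left
      apply Circle.ext
      apply Complex.ext
      · change a = -c
        nlinarith [sq_nonneg (a + c), sq_nonneg (b + d)]
      · change b = -d
        nlinarith [sq_nonneg (a + c), sq_nonneg (b + d)]
  · right; right; right
    linarith

/-- On an open half circle, the arc relation is transitive. -/
lemma arc_trans_of_half {p a b c : Circle} (ha : Arc p a) (hb : Arc p b) (hc : Arc p c)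
    (hab : Arc a b) (hbc : Arc b c) : Arc a c := by
  rw [arc_iff] at *
  -- Plücker's relation for determinants: `[p b][a c] = [p a][b c] + [p c][a b]`.
  refine pos_of_mul_pos_right (a := (p : ℂ).re * (b : ℂ).im - (p : ℂ).im * (b : ℂ).re) ?_ hb.le
  have h1 := mul_pos ha hbc
  have h2 := mul_pos hc hab
  nlinarith

lemma not_arc_neg (x : Circle) : ¬ Arc x (-x) := fun h => arc_irrefl x (arc_neg_right.1 h)

/-! ## The sets `S` and `D` -/

/-- The irrationality of π keeps `S` off the imaginary axis and, through half angles, makes `S` and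
`-S` disjoint. -/
lemma rat_ne_odd_mul_pi (q : ℚ) (n : ℤ) : (q : ℝ) ≠ (2 * n + 1) * (Real.pi / 2) := by
  intro h
  have hn : ((2 * n + 1 : ℤ) : ℝ) ≠ 0 := by exact_mod_cast (by omega : (2 * n + 1 : ℤ) ≠ 0)
  refine irrational_pi ⟨2 * q / (2 * n + 1 : ℤ), ?_⟩
  push_cast at hn ⊢
  rw [div_eq_iff hn, h]
  ring

lemma re_ne_zero_of_mem_S {z : Circle} (hz : z ∈ S) : (z : ℂ).re ≠ 0 := by
  obtain ⟨q, rfl⟩ := hz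
  rw [Circle.coe_exp, Complex.exp_ofReal_mul_I_re]
  intro h
  obtain ⟨k, hk⟩ := Real.cos_eq_zero_iff.1 h
  refine rat_ne_odd_mul_pi q k ?_
  rw [hk]; ring

lemma neg_notMem_S {z : Circle} (hz : z ∈ S) : -z ∉ S := by
  obtain ⟨q, rfl⟩ := hz
  rintro ⟨r, hr⟩
  refine re_ne_zero_of_mem_S (z := Circle.exp ((r - q) / 2 : ℚ)) ⟨_, rfl⟩ ?_
  have h : Circle.exp ((r : ℝ) - q) = -1 := by
    rw [Circle.exp_sub, hr, neg_div, div_self']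
  have h2 := congrArg (fun z : Circle => (z : ℂ).re) h
  simp only [Circle.coe_exp, Complex.exp_ofReal_mul_I_re, Circle.coe_neg, Complex.neg_re,
    Circle.coe_one, Complex.one_re] at h2
  rw [show (r : ℝ) - q = 2 * ((r - q) / 2) by ring, Real.cos_two_mul] at h2
  rw [Circle.coe_exp, Complex.exp_ofReal_mul_I_re]
  push_cast
  exact pow_eq_zero_iff two_ne_zero |>.1 (by linarith)

lemma neg_mem_D {z : Circle} (hz : z ∈ D) : -z ∈ D := by
  rcases hz with h | h
  · exact Or.inr (by rwa [Set.mem_neg, neg_neg])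
  · exact Or.inl h

/-- The antipode of a point of `S ∪ (-S)`. -/
noncomputable def negD (d : D) : D := ⟨-d.1, neg_mem_D d.2⟩

lemma negD_negD (d : D) : negD (negD d) = d := Subtype.ext (neg_neg d.1)

lemma negD_toD (x : S2) : negD x.toD = x.antipode := rfl

lemma negD_antipode (x : S2) : negD x.antipode = x.toD := negD_negD x.toD

lemma eq_toD_or_antipode (d : D) : ∃ x : S2, d = x.toD ∨ d = x.antipode := by
  rcases d with ⟨d, h | h⟩
  · exact ⟨⟨d, h⟩, Or.inl rfl⟩
  · exact ⟨⟨-d, h⟩, Or.inr (Subtype.ext (neg_neg d).symm)⟩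

/-- The point `exp (i q)` as a vertex of `S(2)`. -/
noncomputable def S2.ofRat (q : ℚ) : S2 := ⟨Circle.exp q, q, rfl⟩

lemma S2.exists_between {p q : Circle} (h : Arc p q) : ∃ x : S2, Arc p x.pt ∧ Arc x.pt q := by
  obtain ⟨a, b, hab, hb, rfl, rfl⟩ := h.exists_exp
  obtain ⟨r, har, hrb⟩ := exists_rat_btwn hab
  exact ⟨S2.ofRat r, arc_exp har (by linarith), arc_exp hrb (by linarith)⟩

lemma circle_ne_neg (x : Circle) : x ≠ -x := fun h =>
  Circle.coe_ne_zero x (self_eq_neg.1 (congrArg (fun z : Circle => (z : ℂ)) h))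

lemma S2.exists_arc (p : Circle) : ∃ x : S2, Arc p x.pt := by
  have h0 : Arc p (Circle.exp (Real.pi / 2) * p) := by
    have := arc_exp (a := Complex.arg p) (b := Real.pi / 2 + Complex.arg p)
      (by linarith [Real.pi_pos]) (by linarith [Real.pi_pos])
    rwa [Circle.exp_add, Circle.exp_arg] at this
  obtain ⟨x, hx, -⟩ := S2.exists_between h0
  exact ⟨x, hx⟩

namespace That

/-! ## Half circles of the doubled circle -/

/-- The half circle of the points of the doubled circle that are followed by `d` within a half
turn. It is `[d, -d]`. -/
noncomputable def half (d : D) : Set That :=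
  {t | Arc t.proj d ∨ t = dbl d 0 ∨ t = dbl (negD d) 1}

/-- The label of a doubled point; the value at the other points is irrelevant. -/
def side : That → Fin 2 := Sum.elim (fun _ => 0) (fun e => e.2)

lemma eq_dbl_iff {t : That} {d : D} {i : Fin 2} : t = dbl d i ↔ t.proj = d ∧ t.side = i := by
  constructor
  · rintro rfl
    exact ⟨rfl, rfl⟩
  · rintro ⟨h1, h2⟩
    rcases t with z | ⟨e, j⟩
    · exact absurd (show z.1 ∈ D from (show z.1 = d from h1) ▸ d.2) z.2
    · obtain rfl : e = d := Subtype.ext h1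
      obtain rfl : j = i := h2
      rfl

lemma mem_half {t : That} {d : D} : t ∈ half d ↔
    Arc t.proj d ∨ t.proj = d ∧ t.side = 0 ∨ t.proj = -d ∧ t.side = 1 := by
  rw [half, Set.mem_ofPred_eq, eq_dbl_iff, eq_dbl_iff]
  rfl

/-- The two copies of each boundary point go to opposite sides, so no point is shared or lost. This
is what makes half circles clopen. -/
lemma mem_half_negD {t : That} {d : D} : t ∈ half (negD d) ↔ t ∉ half d := by
  rw [mem_half, mem_half]
  have hc : ((negD d : D) : Circle) = -d := rfl
  have hs : t.side = 0 ∧ t.side ≠ 1 ∨ t.side = 1 ∧ t.side ≠ 0 := by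
    generalize t.side = i
    fin_cases i <;> simp
  have hne := circle_ne_neg d
  rw [hc, neg_neg, arc_neg_right]
  rcases arc_total t.proj d with h | h | h | h
  · have := arc_irrefl (d : Circle)
    rw [h]
    tauto
  · have h1 : ¬ Arc (-(d : Circle)) d := fun h => arc_irrefl _ (arc_neg_left.1 h)
    have h2 := not_arc_neg (d : Circle)
    have h3 := hne.symm
    rw [h]
    tauto
  · have h1 := h.asymm
    have h2 := h.ne
    have h3 : t.proj ≠ -d := fun h0 => arc_irrefl (d : Circle) (arc_neg_left.1 (h0 ▸ h))
    tauto
  · have h1 := h.asymm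
    have h2 := h.ne.symm
    have h3 : t.proj ≠ -d := fun h0 => not_arc_neg (d : Circle) (h0 ▸ h)
    tauto

/-- On a half circle coded by a point, the arc relation is transitive. -/
lemma arc_trans {t : That} {a b c : D} (ha : t ∈ half a) (hb : t ∈ half b) (hc : t ∈ half c)
    (hab : Arc a b) (hbc : Arc b c) : Arc a c := by
  rw [mem_half] at ha hb hc
  generalize t.proj = p at *
  generalize t.side = i at *
  have neg : ∀ {d : D}, p = -(d : Circle) → (d : Circle) = -p := fun h => by rw [h, neg_neg]
  rcases ha with ha | ⟨ha, ha'⟩ | ⟨ha, ha'⟩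
  · rcases hb with hb | ⟨hb, hb'⟩ | ⟨hb, hb'⟩
    · rcases hc with hc | ⟨hc, hc'⟩ | ⟨hc, hc'⟩
      · exact arc_trans_of_half ha hb hc hab hbc
      · exact absurd (hc ▸ hbc) hb.asymm
      · rw [neg hc, arc_neg_right]
        exact ha
    · exact absurd (hb ▸ hab) ha.asymm
    · rcases hc with hc | ⟨hc, hc'⟩ | ⟨hc, hc'⟩
      · rw [neg hb, arc_neg_left] at hbc
        exact absurd hbc hc.asymm
      · subst hb'
        exact absurd hc' (by decide)
      · rw [neg hb, neg hc] at hbc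
        exact absurd hbc (arc_irrefl _)
  · rcases hc with hc | ⟨hc, hc'⟩ | ⟨hc, hc'⟩
    · rwa [← ha]
    · rcases hb with hb | ⟨hb, hb'⟩ | ⟨hb, hb'⟩
      · exact absurd (hc ▸ hbc) hb.asymm
      · exact absurd (ha ▸ hb ▸ hab) (arc_irrefl _)
      · subst hb'
        exact absurd hc' (by decide)
    · subst hc'
      exact absurd ha' (by decide)
  · rcases hb with hb | ⟨hb, hb'⟩ | ⟨hb, hb'⟩
    · rw [neg ha, arc_neg_left] at hab
      exact absurd hab hb.asymm
    · subst hb'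
      exact absurd ha' (by decide)
    · rw [neg ha, neg hb] at hab
      exact absurd hab (arc_irrefl _)

/-- Antipodal half circles are disjoint, which excludes the only incomparable case. With
`arc_trans`, the half circles containing `t` are linearly ordered by arcs. -/
lemma eq_or_arc {t : That} {a b : D} (ha : t ∈ half a) (hb : t ∈ half b) :
    a = b ∨ Arc a b ∨ Arc b a := by
  rcases arc_total a b with h | h | h
  · exact Or.inl (Subtype.ext h)
  · obtain rfl : a = negD b := Subtype.ext h
    exact absurd hb (mem_half_negD.1 ha)
  · exact Or.inr h

/-- Otherwise `t` lies in the half circle of `-b`, and `a → c → -b → a` is a cycle in the linear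
order attached to `t`. -/
lemma mem_half_of_arc {t : That} {a b c : D} (ha : t ∈ half a) (hc : t ∈ half c)
    (hab : Arc a b) (hbc : Arc b c) (hac : Arc a c) : t ∈ half b := by
  by_contra hb
  rw [← mem_half_negD] at hb
  have h1 : Arc c (negD b) := arc_neg_right.2 hbc
  have h2 : Arc (negD b) a := arc_neg_left.2 hab
  exact (arc_trans ha hc hb hac h1).asymm h2

lemma interval_eq {α β : D} (h : Arc β α) : interval α β = half α ∩ half (negD β) := by
  ext t
  rw [Set.mem_inter_iff, mem_half, mem_half, interval]
  simp only [Set.mem_union, Set.mem_singleton_iff, Set.mem_ofPred_eq, eq_dbl_iff]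
  have hc : ((negD β : D) : Circle) = -β := rfl
  rw [hc, neg_neg, arc_neg_right]
  constructor
  · rintro ((⟨h1, h2⟩ | ⟨h1, h2⟩) | ⟨h1, h2⟩)
    · exact ⟨Or.inr (Or.inl ⟨h1, h2⟩), Or.inl (h1 ▸ h)⟩
    · exact ⟨Or.inl h1, Or.inl h2⟩
    · exact ⟨Or.inl (h1 ▸ h), Or.inr (Or.inr ⟨h1, h2⟩)⟩
  · rintro ⟨h1 | ⟨h1, h1'⟩ | ⟨h1, h1'⟩, h2 | ⟨h2, h2'⟩ | ⟨h2, h2'⟩⟩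
    · exact Or.inl (Or.inr ⟨h1, h2⟩)
    · rw [h2, arc_neg_left] at h1
      exact absurd h1 h.asymm
    · exact Or.inr ⟨h2, h2'⟩
    · exact Or.inl (Or.inl ⟨h1, h1'⟩)
    · exact absurd h (by rw [← h1, h2]; exact not_arc_neg _)
    · exact absurd h (by rw [← h1, ← h2]; exact arc_irrefl _)
    · rw [h1, arc_neg_right] at h2
      exact absurd h2 h.asymm
    · exact absurd (h1'.symm.trans h2') (by decide)
    · exact absurd h (by rw [← h2, h1, arc_neg_left]; exact arc_irrefl _)

/-- The basic open sets, as intersections of two half circles. -/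
lemma mem_intervals {I : Set That} :
    I ∈ intervals ↔ ∃ a b : D, Arc a b ∧ I = half a ∩ half b := by
  constructor
  · rintro ⟨α, β, h, rfl⟩
    exact ⟨α, negD β, arc_neg_right.2 h, interval_eq h⟩
  · rintro ⟨a, b, h, rfl⟩
    have h' : Arc (negD b) a := arc_neg_left.2 h
    exact ⟨a, negD b, h', by rw [interval_eq h', negD_negD]⟩

lemma exists_ne_mem_half (t : That) (d : D) : ∃ e : D, e ≠ d ∧ t ∈ half e := by
  obtain ⟨x, hx⟩ := S2.exists_arc t.proj
  obtain ⟨y, hy, hyx⟩ := S2.exists_between hx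
  by_cases h : x.toD = d
  · refine ⟨y.toD, ?_, mem_half.2 (Or.inl hy)⟩
    rw [← h]
    exact fun h' => hyx.ne (congrArg (fun e : D => (e : Circle)) h')
  · exact ⟨x.toD, h, mem_half.2 (Or.inl hx)⟩

lemma half_inter_half_mem_intervals {t : That} {a b : D} (ha : t ∈ half a) (hb : t ∈ half b)
    (hab : a ≠ b) : half a ∩ half b ∈ intervals := by
  rcases eq_or_arc ha hb with h | h | h
  · exact absurd h hab
  · exact mem_intervals.2 ⟨a, b, h, rfl⟩
  · exact mem_intervals.2 ⟨b, a, h, Set.inter_comm _ _⟩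

lemma isOpen_half (d : D) : IsOpen (half d) := by
  refine isOpen_iff_forall_mem_open.2 fun t ht => ?_
  obtain ⟨e, hed, he⟩ := exists_ne_mem_half t d
  exact ⟨half d ∩ half e, Set.inter_subset_left,
    .basic _ (half_inter_half_mem_intervals ht he hed.symm), ht, he⟩

/-- Among the four half circles bounding two basic sets at `t`, the first and the last in the order
at `t` suffice: by `mem_half_of_arc` their intersection lies in the other two. -/
theorem isTopologicalBasis_intervals : TopologicalSpace.IsTopologicalBasis intervals where
  exists_subset_inter := by
    intro I hI J hJ t ht
    obtain ⟨a, b, hab, rfl⟩ := mem_intervals.1 hI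
    obtain ⟨a', b', hab', rfl⟩ := mem_intervals.1 hJ
    obtain ⟨⟨ha, hb⟩, ha', hb'⟩ := ht
    have first : ∃ c : D, t ∈ half c ∧ (c = a ∨ Arc c a) ∧ (c = a' ∨ Arc c a') := by
      rcases eq_or_arc ha ha' with h | h | h
      · exact ⟨a, ha, Or.inl rfl, Or.inl h⟩
      · exact ⟨a, ha, Or.inl rfl, Or.inr h⟩
      · exact ⟨a', ha', Or.inr h, Or.inl rfl⟩
    have last : ∃ c : D, t ∈ half c ∧ (c = b ∨ Arc b c) ∧ (c = b' ∨ Arc b' c) := by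
      rcases eq_or_arc hb hb' with h | h | h
      · exact ⟨b, hb, Or.inl rfl, Or.inl h⟩
      · exact ⟨b', hb', Or.inr h, Or.inl rfl⟩
      · exact ⟨b, hb, Or.inl rfl, Or.inr h⟩
    obtain ⟨c, hc, hca, hca'⟩ := first
    obtain ⟨d, hd, hdb, hdb'⟩ := last
    have hcb : Arc c b := by
      rcases hca with rfl | h
      exacts [hab, arc_trans hc ha hb h hab]
    have hcb' : Arc c b' := by
      rcases hca' with rfl | h
      exacts [hab', arc_trans hc ha' hb' h hab']
    have hcd : Arc c d := by
      rcases hdb with rfl | h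
      exacts [hcb, arc_trans hc hb hd hcb h]
    have had : Arc a d := by
      rcases hdb with rfl | h
      exacts [hab, arc_trans ha hb hd hab h]
    have had' : Arc a' d := by
      rcases hdb' with rfl | h
      exacts [hab', arc_trans ha' hb' hd hab' h]
    refine ⟨half c ∩ half d, mem_intervals.2 ⟨c, d, hcd, rfl⟩, ⟨hc, hd⟩, ?_⟩
    rintro s ⟨hsc, hsd⟩
    refine ⟨⟨?_, ?_⟩, ?_, ?_⟩
    · rcases hca with rfl | h
      exacts [hsc, mem_half_of_arc hsc hsd h had hcd]
    · rcases hdb with rfl | h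
      exacts [hsd, mem_half_of_arc hsc hsd hcb h hcd]
    · rcases hca' with rfl | h
      exacts [hsc, mem_half_of_arc hsc hsd h had' hcd]
    · rcases hdb' with rfl | h
      exacts [hsd, mem_half_of_arc hsc hsd hcb' h hcd]
  sUnion_eq := by
    refine Set.eq_univ_of_forall fun t => ?_
    obtain ⟨d, -, hd⟩ := exists_ne_mem_half t (S2.ofRat 0).toD
    obtain ⟨e, hed, he⟩ := exists_ne_mem_half t d
    exact ⟨_, half_inter_half_mem_intervals hd he hed.symm, hd, he⟩
  eq_generateFrom := rfl

/-- A point of the doubled circle is determined by the half circles it belongs to. -/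
lemma ext_half {t t' : That} (h : ∀ d, t ∈ half d → t' ∈ half d) : t = t' := by
  have arc_of : ∀ x : S2, Arc t.proj x.pt → ¬ Arc x.pt t'.proj := by
    intro x hx hx'
    have h1 : t' ∈ half x.antipode := mem_half.2 (Or.inl (arc_neg_right.2 hx'))
    rw [← negD_toD, mem_half_negD] at h1
    exact h1 (h _ (mem_half.2 (Or.inl hx)))
  have hp : t.proj = t'.proj := by
    rcases arc_total t.proj t'.proj with h' | h' | h' | h'
    · exact h'
    · obtain ⟨x, hx⟩ := S2.exists_arc t.proj
      refine absurd ?_ (arc_of x hx)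
      rwa [h', arc_neg_left] at hx
    · obtain ⟨x, hx, hx'⟩ := S2.exists_between h'
      exact absurd hx' (arc_of x hx)
    · obtain ⟨x, hx, hx'⟩ := S2.exists_between h'
      have h1 : t ∈ half x.antipode := mem_half.2 (Or.inl (arc_neg_right.2 hx'))
      have h2 := h _ h1
      rw [← negD_toD, mem_half_negD] at h2
      exact absurd (mem_half.2 (Or.inl hx)) h2
  by_cases hD : t'.proj ∈ D
  · refine (eq_dbl_iff (d := ⟨t'.proj, hD⟩) (i := t'.side)).2 ⟨hp, ?_⟩ |>.trans
      (eq_dbl_iff.2 ⟨rfl, rfl⟩).symm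
    have h1 := h ⟨t'.proj, hD⟩
    have h2 := h (negD ⟨t'.proj, hD⟩)
    rw [mem_half_negD, mem_half_negD] at h2
    have h3 := not_iff_not.1 (⟨h2, fun h' h'' => h' (h1 h'')⟩)
    rw [mem_half, mem_half] at h3
    simp only [hp, arc_irrefl, circle_ne_neg, true_and, false_and, or_false, false_or] at h3
    generalize t.side = i at *
    generalize t'.side = j at *
    revert h3
    fin_cases i <;> fin_cases j <;> decide
  · rcases t with z | e
    · rcases t' with z' | e'
      · exact congrArg Sum.inl (Subtype.ext hp)
      · exact absurd e'.1.2 hD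
    · exact absurd (hp ▸ e.1.2) hD

end That
-- Transitive choices from antipodal pairs as points of the doubled circle
lemma circle_exp_pi : Circle.exp Real.pi = -1 :=
  Circle.ext (by rw [Circle.coe_exp, Complex.exp_pi_mul_I]; rfl)

namespace That

/-- A choice of one point in each antipodal pair of `S ∪ (-S)` on which the arc relation is
transitive is given by a point of the doubled circle. -/
theorem exists_mem_half_iff (τ : D → Prop) (hneg : ∀ d, τ (negD d) ↔ ¬ τ d)
    (htrans : ∀ a b c, τ a → τ b → τ c → Arc a b → Arc b c → Arc a c) :
    ∃ t : That, ∀ d, t ∈ half d ↔ τ d := by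
  have hconv : ∀ a b c : D, τ a → τ c → Arc a b → Arc b c → Arc a c → τ b := by
    intro a b c ha hc hab hbc hac
    by_contra hb
    rw [← hneg] at hb
    exact (htrans a c _ ha hc hb hac (arc_neg_right.2 hbc)).asymm (arc_neg_left.2 hab)
  obtain ⟨d₀, hd₀⟩ : ∃ d, τ d := by
    by_cases h : τ (S2.ofRat 0).toD
    exacts [⟨_, h⟩, ⟨_, (hneg _).2 h⟩]
  obtain ⟨a, ha⟩ : ∃ a : ℝ, Circle.exp a = d₀ := ⟨_, Circle.exp_arg _⟩
  -- Clockwise angles from `d₀` to selected points. Convexity fills in all smaller angles of points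
  -- of `D`, so the supremum locates the end of the half circle.
  set U : Set ℝ := {θ | 0 ≤ θ ∧ θ < Real.pi ∧ ∃ d, τ d ∧ (d : Circle) = Circle.exp (a - θ)} with hU
  have h0U : (0 : ℝ) ∈ U := ⟨le_rfl, Real.pi_pos, d₀, hd₀, by rw [sub_zero, ha]⟩
  have hbdd : BddAbove U := ⟨Real.pi, fun θ hθ => hθ.2.1.le⟩
  set s := sSup U
  have hs0 : 0 ≤ s := le_csSup hbdd h0U
  have hdown : ∀ θ ∈ U, ∀ θ', 0 ≤ θ' → θ' < θ → ∀ d : D, (d : Circle) = Circle.exp (a - θ') →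
      τ d := by
    rintro θ ⟨h1, h2, d, hd, hdθ⟩ θ' h0 hlt d' hd'
    rcases h0.eq_or_lt with rfl | h0
    · rw [sub_zero, ha] at hd'
      rwa [Subtype.ext hd']
    · refine hconv d d' d₀ hd hd₀ ?_ ?_ ?_
      · rw [hdθ, hd']
        exact arc_exp (by linarith) (by linarith)
      · rw [hd', ← ha]
        exact arc_exp (by linarith) (by linarith)
      · rw [hdθ, ← ha]
        exact arc_exp (by linarith) (by linarith)
  set p : Circle := Circle.exp (a - s) with hp
  have key : ∀ d : D, Arc p d → τ d := by
    intro d hd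
    set φ := Complex.arg ((d / p : Circle) : ℂ) with hφ
    have hdφ : (d : Circle) = Circle.exp (a - (s - φ)) := by
      rw [show a - (s - φ) = φ + (a - s) by ring, Circle.exp_add, hφ, Circle.exp_arg, ← hp,
        div_mul_cancel]
    have hφ0 : 0 < φ := hd.1
    have hφπ : φ < Real.pi := hd.2
    rcases le_or_gt φ s with h | h
    · obtain ⟨θ, hθ, hlt⟩ := exists_lt_of_lt_csSup ⟨0, h0U⟩ (show s - φ < s by linarith)
      exact hdown θ hθ _ (by linarith) hlt d hdφ
    · by_contra hτ
      rw [← hneg] at hτ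
      -- If `d` lies beyond `d₀` and is not selected, its antipode is selected, at a clockwise angle
      -- exceeding the supremum because `φ < π`.
      have : s - φ + Real.pi ∈ U := by
        refine ⟨by linarith, by linarith, negD d, hτ, ?_⟩
        rw [show a - (s - φ + Real.pi) = a - (s - φ) - Real.pi by ring, Circle.exp_sub, ← hdφ,
          circle_exp_pi, div_neg, div_one]
        rfl
      linarith [le_csSup hbdd this]
  obtain ⟨t, ht, hside⟩ : ∃ t : That, t.proj = p ∧
      ∀ d : D, p = d → (τ d → t.side = 0) ∧ (¬ τ d → t.side = 1) := by
    by_cases hpD : p ∈ D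
    · by_cases hτ : τ ⟨p, hpD⟩
      · refine ⟨dbl ⟨p, hpD⟩ 0, rfl, ?_⟩
        rintro ⟨d, hd⟩ rfl
        exact ⟨fun _ => rfl, fun h => absurd hτ h⟩
      · refine ⟨dbl ⟨p, hpD⟩ 1, rfl, ?_⟩
        rintro ⟨d, hd⟩ rfl
        exact ⟨fun h => absurd h hτ, fun _ => rfl⟩
    · exact ⟨Sum.inl ⟨p, hpD⟩, rfl, fun d hd => absurd (hd ▸ d.2) hpD⟩
  have imp : ∀ d, τ d → t ∈ half d := by
    intro d hd
    rw [mem_half, ht]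
    rcases arc_total p d with h | h | h | h
    · exact Or.inr (Or.inl ⟨h, (hside d h).1 hd⟩)
    · refine Or.inr (Or.inr ⟨h, (hside (negD d) h).2 fun h' => (hneg d).1 h' hd⟩)
    · exact Or.inl h
    · exact absurd hd ((hneg d).1 (key (negD d) (arc_neg_right.2 h)))
  refine ⟨t, fun d => ⟨fun h => ?_, imp d⟩⟩
  by_contra hd
  exact mem_half_negD.1 (imp _ ((hneg d).2 hd)) h

end That

/-! ## Half circles of `S(2)` -/

lemma halves_fst (t : That) (x : S2) : (halves t).1 x = true ↔ t ∈ That.half x.toD := by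
  simp only [halves, decide_eq_true_eq]
  exact Iff.rfl

lemma halves_snd (t : That) (x : S2) : (halves t).2 x = true ↔ t ∈ That.half x.antipode := by
  simp only [halves, decide_eq_true_eq]
  rw [← negD_toD, That.half, negD_negD]
  change Arc x.pt t.proj ∨ _ ↔ Arc t.proj (-x.pt) ∨ t = That.dbl x.antipode 0 ∨ t = That.dbl x.toD 1
  rw [arc_neg_right]
  tauto

/-- The arc relation with the arcs between the two parts of a partition reversed. -/
def cutLT (T : S2 → Bool) (x y : S2) : Prop := if T x = T y then x.arc y else y.arc x

/-- A partition of `S(2)` into two parts such that reversing the arcs between them gives a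
transitive relation. -/
def IsCut (T : UnaryPairs) : Prop :=
  (∀ x, T.2 x = !T.1 x) ∧ ∀ x y z, cutLT T.1 x y → cutLT T.1 y z → cutLT T.1 x z

/-- `d` is the one among `x` and its antipode which is selected by `T`. -/
def Selects (T : S2 → Bool) (x : S2) (d : D) : Prop :=
  d = x.toD ∧ T x = true ∨ d = x.antipode ∧ T x = false

lemma toD_ne_antipode (x y : S2) : x.toD ≠ y.antipode := fun h =>
  have h' : x.pt = -y.pt := congrArg (fun d : D => (d : Circle)) h
  neg_notMem_S y.pt_mem (h' ▸ x.pt_mem)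

lemma toD_injective {x y : S2} (h : x.toD = y.toD) : x = y :=
  Subtype.ext (congrArg (fun d : D => (d : Circle)) h)

lemma antipode_injective {x y : S2} (h : x.antipode = y.antipode) : x = y :=
  toD_injective (by rw [← negD_antipode, h, negD_antipode])

/-- Passing to the antipode of one endpoint reverses an arc, and of both preserves it: transitivity
of `cutLT` is thus transitivity of arcs among selected points. -/
lemma Selects.arc_iff {T : S2 → Bool} {x y : S2} {a b : D} (ha : Selects T x a)
    (hb : Selects T y b) : Arc a b ↔ cutLT T x y := by
  rcases ha with ⟨rfl, hx⟩ | ⟨rfl, hx⟩ <;> rcases hb with ⟨rfl, hy⟩ | ⟨rfl, hy⟩ <;>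
    rw [cutLT, hx, hy]
  · simp only [if_true]
    exact Iff.rfl
  · simp only [Bool.true_eq_false, if_false]
    exact arc_neg_right (x := x.pt) (y := y.pt)
  · simp only [Bool.false_eq_true, if_false]
    exact arc_neg_left (x := x.pt) (y := y.pt)
  · simp only [if_true]
    exact (arc_neg_left (x := x.pt) (y := -y.pt)).trans
      ((arc_neg_left (x := y.pt) (y := x.pt)))

lemma exists_selects_halves (t : That) (x : S2) :
    ∃ d, Selects (halves t).1 x d ∧ t ∈ That.half d := by
  by_cases h : t ∈ That.half x.toD
  · exact ⟨x.toD, Or.inl ⟨rfl, (halves_fst t x).2 h⟩, h⟩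
  · refine ⟨x.antipode, Or.inr ⟨rfl, ?_⟩, (That.mem_half_negD (d := x.toD)).2 h⟩
    rw [← halves_fst, Bool.not_eq_true] at h
    exact h

lemma isCut_halves (t : That) : IsCut (halves t) := by
  refine ⟨fun x => ?_, fun x y z hxy hyz => ?_⟩
  · rw [Bool.eq_iff_iff, halves_snd, Bool.not_eq_true', ← Bool.not_eq_true, halves_fst,
      ← negD_toD, That.mem_half_negD]
  · obtain ⟨a, hax, ha⟩ := exists_selects_halves t x
    obtain ⟨b, hby, hb⟩ := exists_selects_halves t y
    obtain ⟨c, hcz, hc⟩ := exists_selects_halves t z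
    rw [← hax.arc_iff hcz]
    exact That.arc_trans ha hb hc ((hax.arc_iff hby).2 hxy) ((hby.arc_iff hcz).2 hyz)

/-- As `S` and `-S` are disjoint, the partition can be read back from the selected points of `D`, to
which `That.exists_mem_half_iff` applies. -/
lemma IsCut.exists_halves {T : UnaryPairs} (hT : IsCut T) : ∃ t, halves t = T := by
  have htoD : ∀ x, (∃ y, Selects T.1 y x.toD) ↔ T.1 x = true := by
    refine fun x => ⟨?_, fun h => ⟨x, Or.inl ⟨rfl, h⟩⟩⟩
    rintro ⟨y, ⟨h, hy⟩ | ⟨h, hy⟩⟩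
    · rwa [toD_injective h]
    · exact absurd h (toD_ne_antipode _ _)
  have hanti : ∀ x, (∃ y, Selects T.1 y x.antipode) ↔ ¬ T.1 x = true := by
    refine fun x => ⟨?_, fun h => ⟨x, Or.inr ⟨rfl, Bool.eq_false_iff.2 h⟩⟩⟩
    rintro ⟨y, ⟨h, hy⟩ | ⟨h, hy⟩⟩
    · exact absurd h.symm (toD_ne_antipode _ _)
    · rw [antipode_injective h, hy]
      exact Bool.false_ne_true
  obtain ⟨t, ht⟩ := That.exists_mem_half_iff (fun d => ∃ y, Selects T.1 y d) (by
      intro d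
      obtain ⟨x, rfl | rfl⟩ := eq_toD_or_antipode d
      · rw [negD_toD, hanti, htoD]
      · rw [negD_antipode, hanti, htoD, not_not]) (by
      rintro a b c ⟨x, ha⟩ ⟨y, hb⟩ ⟨z, hc⟩ hab hbc
      rw [ha.arc_iff hb] at hab
      rw [hb.arc_iff hc] at hbc
      exact (ha.arc_iff hc).2 (hT.2 x y z hab hbc))
  refine ⟨t, Prod.ext (funext fun x => ?_) (funext fun x => ?_)⟩
  · rw [Bool.eq_iff_iff, halves_fst, ht, htoD]
  · rw [hT.1, Bool.eq_iff_iff, halves_snd, ht, hanti, Bool.not_eq_true, Bool.not_eq_true']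

lemma range_halves : Set.range halves = {T | IsCut T} := by
  ext T
  exact ⟨by rintro ⟨t, rfl⟩; exact isCut_halves t, fun h => h.exists_halves⟩

lemma cutLT_smul (g : AutS2) (T : UnaryPairs) (x y : S2) :
    cutLT (g • T).1 x y ↔ cutLT T.1 (g⁻¹ x) (g⁻¹ y) := by
  change (if T.1 (g⁻¹ x) = T.1 (g⁻¹ y) then _ else _) ↔ if _ then _ else _
  split_ifs
  · exact (g⁻¹).map_rel_iff.symm
  · exact (g⁻¹).map_rel_iff.symm

lemma IsCut.smul {T : UnaryPairs} (hT : IsCut T) (g : AutS2) : IsCut (g • T) := by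
  refine ⟨fun x => hT.1 (g⁻¹ x), fun x y z => ?_⟩
  rw [cutLT_smul, cutLT_smul, cutLT_smul]
  exact hT.2 _ _ _

/-- Each instance of the two conditions involves at most three vertices, hence is clopen. -/
lemma isClosed_isCut : IsClosed {T | IsCut T} := by
  have h1 : ∀ x, Continuous fun T : UnaryPairs => T.1 x := fun x =>
    (continuous_apply x).comp continuous_fst
  have h2 : ∀ x, Continuous fun T : UnaryPairs => T.2 x := fun x =>
    (continuous_apply x).comp continuous_snd
  have h : {T | IsCut T} = (⋂ x, {T | T.2 x = !T.1 x}) ∩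
      ⋂ x, ⋂ y, ⋂ z, {T | cutLT T.1 x y → cutLT T.1 y z → cutLT T.1 x z} := by
    ext T
    simp only [IsCut, Set.mem_ofPred_eq, Set.mem_inter_iff, Set.mem_iInter]
  rw [h]
  refine IsClosed.inter (isClosed_iInter fun x => isClosed_eq (h2 x)
      ((continuous_of_discreteTopology (f := Bool.not)).comp (h1 x)))
    (isClosed_iInter fun x => isClosed_iInter fun y => isClosed_iInter fun z => ?_)
  exact (isClosed_discrete {b : Bool × Bool × Bool |
    (if b.1 = b.2.1 then x.arc y else y.arc x) → (if b.2.1 = b.2.2 then y.arc z else z.arc y) →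
      (if b.1 = b.2.2 then x.arc z else z.arc x)}).preimage
    ((h1 x).prodMk ((h1 y).prodMk (h1 z)))

/-! ## `S(2)` as a linear order with reversed arcs between two dense parts -/

/-- The slope of the line through a vertex and the origin. -/
noncomputable def slope (x : S2) : ℝ := (x.pt : ℂ).im / (x.pt : ℂ).re

lemma re_pt_ne_zero (x : S2) : (x.pt : ℂ).re ≠ 0 := re_ne_zero_of_mem_S x.pt_mem

lemma halfPlanes_fst (x : S2) : halfPlanes.1 x = true ↔ 0 < (x.pt : ℂ).re :=
  @decide_eq_true_iff _ (Classical.propDecidable _)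

lemma halfPlanes_snd (x : S2) : halfPlanes.2 x = !halfPlanes.1 x := by
  have h : halfPlanes.2 x = true ↔ (x.pt : ℂ).re < 0 := decide_eq_true_iff
  rw [Bool.eq_iff_iff, h, Bool.not_eq_true', ← Bool.not_eq_true, halfPlanes_fst, not_lt]
  exact ⟨le_of_lt, fun h => lt_of_le_of_ne h (re_pt_ne_zero x)⟩

/-- The determinant is the product of the real parts times the difference of slopes, and the sign of
that product tells whether the half planes agree. -/
lemma arc_iff_slope (x y : S2) : x.arc y ↔
    if halfPlanes.1 x = halfPlanes.1 y then slope x < slope y else slope y < slope x := by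
  have hx := re_pt_ne_zero x
  have hy := re_pt_ne_zero y
  have hprod : (x.pt : ℂ).re * (y.pt : ℂ).im - (x.pt : ℂ).im * (y.pt : ℂ).re
      = ((x.pt : ℂ).re * (y.pt : ℂ).re) * (slope y - slope x) := by
    rw [slope, slope]
    field_simp
  have hcol : halfPlanes.1 x = halfPlanes.1 y ↔ (0 < (x.pt : ℂ).re ↔ 0 < (y.pt : ℂ).re) := by
    rw [Bool.eq_iff_iff, halfPlanes_fst, halfPlanes_fst]
  rw [S2.arc, arc_iff, hprod]
  simp only [hcol]
  rcases lt_or_gt_of_ne hx with hx | hx <;> rcases lt_or_gt_of_ne hy with hy | hy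
  · rw [if_pos (iff_of_false hx.not_gt hy.not_gt),
      mul_pos_iff_of_pos_left (mul_pos_of_neg_of_neg hx hy), sub_pos]
  · rw [if_neg fun h => hx.not_gt (h.2 hy), ← neg_mul_neg,
      mul_pos_iff_of_pos_left (neg_pos.2 (mul_neg_of_neg_of_pos hx hy)), neg_sub, sub_pos]
  · rw [if_neg fun h => hy.not_gt (h.1 hx), ← neg_mul_neg,
      mul_pos_iff_of_pos_left (neg_pos.2 (mul_neg_of_pos_of_neg hx hy)), neg_sub, sub_pos]
  · rw [if_pos (iff_of_true hx hy), mul_pos_iff_of_pos_left (mul_pos hx hy), sub_pos]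

lemma cutLT_halfPlanes (x y : S2) : cutLT halfPlanes.1 x y ↔ slope x < slope y := by
  rw [cutLT, arc_iff_slope, arc_iff_slope]
  split_ifs with h1 h2
  · exact Iff.rfl
  · exact absurd h2.symm h1
  · exact Iff.rfl

lemma isCut_halfPlanes : IsCut halfPlanes := by
  refine ⟨halfPlanes_snd, fun x y z => ?_⟩
  rw [cutLT_halfPlanes, cutLT_halfPlanes, cutLT_halfPlanes]
  exact lt_trans

lemma slope_injective : Function.Injective slope := by
  intro x y h
  rcases arc_total x.pt y.pt with h' | h' | h' | h'
  · exact Subtype.ext h'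
  · exact absurd x.pt_mem (h' ▸ neg_notMem_S y.pt_mem)
  · have := (arc_iff_slope x y).1 h'
    simp [h] at this
  · have := (arc_iff_slope y x).1 h'
    simp [h] at this

/-- The slope at angle `θ` is `tan θ`, of period π: rational angles between `arctan a` and `arctan
b` serve the right half plane, those in the interval shifted by π the left one. -/
lemma exists_slope_between {a b : ℝ} (hab : a < b) (c : Bool) :
    ∃ x : S2, halfPlanes.1 x = c ∧ a < slope x ∧ slope x < b := by
  have hslope : ∀ q : ℚ, slope (S2.ofRat q) = Real.tan q := by
    intro q
    change ((Circle.exp q : Circle) : ℂ).im / ((Circle.exp q : Circle) : ℂ).re = _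
    rw [Circle.coe_exp, Complex.exp_ofReal_mul_I_re, Complex.exp_ofReal_mul_I_im,
      Real.tan_eq_sin_div_cos]
  have hre : ∀ q : ℚ, ((S2.ofRat q).pt : ℂ).re = Real.cos q := fun q => by
    change ((Circle.exp q : Circle) : ℂ).re = _
    rw [Circle.coe_exp, Complex.exp_ofReal_mul_I_re]
  have hlt := Real.arctan_strictMono hab
  have h1 := Real.neg_pi_div_two_lt_arctan a
  have h5 := Real.arctan_lt_pi_div_two b
  have htan : ∀ θ, Real.arctan a < θ → θ < Real.arctan b →
      a < Real.tan θ ∧ Real.tan θ < b ∧ 0 < Real.cos θ := by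
    intro θ ha hb
    have h3 : -(Real.pi / 2) < θ := by linarith
    have h4 : θ < Real.pi / 2 := by linarith
    refine ⟨?_, ?_, Real.cos_pos_of_mem_Ioo ⟨h3, h4⟩⟩
    · rwa [← Real.arctan_lt_arctan_iff, Real.arctan_tan h3 h4]
    · rwa [← Real.arctan_lt_arctan_iff, Real.arctan_tan h3 h4]
  cases c
  · obtain ⟨q, hq1, hq2⟩ := exists_rat_btwn (add_lt_add_left hlt Real.pi)
    obtain ⟨ha, hb, hc⟩ := htan (q - Real.pi) (by linarith) (by linarith)
    rw [Real.tan_sub_pi] at ha hb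
    rw [Real.cos_sub_pi] at hc
    refine ⟨S2.ofRat q, ?_, by rwa [hslope], by rwa [hslope]⟩
    rw [← Bool.not_eq_true, halfPlanes_fst, hre]
    linarith
  · obtain ⟨q, hq1, hq2⟩ := exists_rat_btwn hlt
    obtain ⟨ha, hb, hc⟩ := htan q hq1 hq2
    exact ⟨S2.ofRat q, by rwa [halfPlanes_fst, hre], by rwa [hslope], by rwa [hslope]⟩

/-! ## The doubled circle as a space of partitions -/

lemma half_toD (x : S2) : That.half x.toD = halves ⁻¹' {T | T.1 x = true} :=
  Set.ext fun t => (halves_fst t x).symm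

lemma half_antipode (x : S2) : That.half x.antipode = halves ⁻¹' {T | T.2 x = true} :=
  Set.ext fun t => (halves_snd t x).symm

lemma That.isClopen_half (d : D) : IsClopen (That.half d) := by
  refine ⟨⟨?_⟩, That.isOpen_half d⟩
  have h : (That.half d)ᶜ = That.half (negD d) := Set.ext fun t => That.mem_half_negD.symm
  rw [h]
  exact That.isOpen_half _

lemma UnaryPairs.continuous_fst_apply (x : S2) : Continuous fun T : UnaryPairs => T.1 x :=
  (continuous_apply x).comp continuous_fst

lemma UnaryPairs.continuous_snd_apply (x : S2) : Continuous fun T : UnaryPairs => T.2 x :=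
  (continuous_apply x).comp continuous_snd

lemma continuous_halves : Continuous halves := by
  refine Continuous.prodMk (continuous_pi fun x => ?_) (continuous_pi fun x => ?_)
  · refine (continuous_bool_rng true).2 ?_
    have := That.isClopen_half x.toD
    rwa [half_toD] at this
  · refine (continuous_bool_rng true).2 ?_
    have := That.isClopen_half x.antipode
    rwa [half_antipode] at this

lemma isInducing_halves : Topology.IsInducing halves := by
  refine ⟨le_antisymm continuous_halves.le_induced (le_generateFrom ?_)⟩
  have key : ∀ d : D, IsOpen[TopologicalSpace.induced halves inferInstance] (That.half d) := by
    intro d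
    obtain ⟨x, rfl | rfl⟩ := eq_toD_or_antipode d
    · exact ⟨_, (isOpen_discrete {true}).preimage (UnaryPairs.continuous_fst_apply x),
        (half_toD x).symm⟩
    · exact ⟨_, (isOpen_discrete {true}).preimage (UnaryPairs.continuous_snd_apply x),
        (half_antipode x).symm⟩
  intro I hI
  obtain ⟨a, b, -, rfl⟩ := That.mem_intervals.1 hI
  exact (TopologicalSpace.induced halves inferInstance).isOpen_inter _ _ (key a) (key b)

lemma halves_injective : Function.Injective halves := by
  intro t t' h
  refine That.ext_half fun d => ?_
  obtain ⟨x, rfl | rfl⟩ := eq_toD_or_antipode d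
  · rw [half_toD, Set.mem_preimage, Set.mem_preimage, h]
    exact id
  · rw [half_antipode, Set.mem_preimage, Set.mem_preimage, h]
    exact id

lemma isEmbedding_halves : Topology.IsEmbedding halves := ⟨isInducing_halves, halves_injective⟩

/-! ## Rotations -/

lemma exp_mul_mem_S (q : ℚ) {z : Circle} (hz : z ∈ S) : Circle.exp q * z ∈ S := by
  obtain ⟨r, rfl⟩ := hz
  exact ⟨q + r, by rw [← Circle.exp_add]; push_cast; rfl⟩

/-- The rotation of `S(2)` by a rational angle. -/
noncomputable def rotation (q : ℚ) : AutS2 where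
  toFun x := ⟨Circle.exp q * x.pt, exp_mul_mem_S q x.pt_mem⟩
  invFun x := ⟨Circle.exp (-q : ℚ) * x.pt, exp_mul_mem_S (-q) x.pt_mem⟩
  left_inv x := Subtype.ext <| by
    change Circle.exp (-q : ℚ) * (Circle.exp q * x.pt) = x.pt
    rw [Rat.cast_neg, Circle.exp_neg, inv_mul_cancel_left]
  right_inv x := Subtype.ext <| by
    change Circle.exp q * (Circle.exp (-q : ℚ) * x.pt) = x.pt
    rw [Rat.cast_neg, Circle.exp_neg, mul_inv_cancel_left]
  map_rel_iff' := arc_mul_left _ _ _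

/-- Only half circles with the rotated projection strictly inside are considered, which avoids
tracking labels and suffices for density. -/
lemma mem_half_of_rotation {q : ℚ} {t t' : That} (h : halves t' = rotation q • halves t) {d : D}
    (hd : Arc (Circle.exp q * t.proj) d) : t' ∈ That.half d := by
  obtain ⟨x, hx⟩ := eq_toD_or_antipode d
  obtain ⟨y, rfl⟩ := (rotation q).surjective x
  have hy : (rotation q)⁻¹ (rotation q y) = y := RelIso.inv_apply_self _ _
  rcases hx with rfl | rfl
  · rw [← halves_fst, h]
    change (halves t).1 ((rotation q)⁻¹ (rotation q y)) = true
    rw [hy, halves_fst]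
    exact That.mem_half.2 (Or.inl ((arc_mul_left _ _ _).1 hd))
  · rw [← halves_snd, h]
    change (halves t).2 ((rotation q)⁻¹ (rotation q y)) = true
    rw [hy, halves_snd]
    have hd' : Arc (Circle.exp q * y.pt) (Circle.exp q * t.proj) := arc_neg_right.1 hd
    exact That.mem_half.2 (Or.inl (arc_neg_right.2 ((arc_mul_left _ _ _).1 hd')))

lemma dense_setOf_halves_mem_orbit (t : That) :
    Dense {t' | halves t' ∈ MulAction.orbit AutS2 (halves t)} := by
  refine That.isTopologicalBasis_intervals.dense_iff.2 fun I hI _ => ?_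
  obtain ⟨a, b, hab, rfl⟩ := That.mem_intervals.1 hI
  obtain ⟨α, β, h1, h2, ha, hb⟩ := hab.exists_exp
  -- The rotated angle must lie in `(β - π, α)`, so that both `a` and `b` follow it within a half
  -- turn.
  obtain ⟨q, hq1, hq2⟩ := exists_rat_btwn
    (show β - Real.pi - Complex.arg t.proj < α - Complex.arg t.proj by linarith)
  obtain ⟨t', ht'⟩ := ((isCut_halves t).smul (rotation q)).exists_halves
  have hp : Circle.exp q * t.proj = Circle.exp (q + Complex.arg t.proj) := by
    rw [Circle.exp_add, Circle.exp_arg]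
  refine ⟨t', ⟨mem_half_of_rotation ht' ?_, mem_half_of_rotation ht' ?_⟩, rotation q, ht'.symm⟩
  · rw [hp, ← ha]
    exact arc_exp (by linarith) (by linarith)
  · rw [hp, ← hb]
    exact arc_exp (by linarith) (by linarith)

lemma That.nontrivial_of_isOpen {U : Set That} (hU : IsOpen U) (hne : U.Nonempty) :
    U.Nontrivial := by
  obtain ⟨t, ht⟩ := hne
  obtain ⟨I, hI, -, hIU⟩ := That.isTopologicalBasis_intervals.exists_subset_of_mem_open ht hU
  obtain ⟨α, β, h, rfl⟩ := hI
  obtain ⟨x, hx, hx'⟩ := S2.exists_between h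
  refine ⟨That.dbl x.toD 0, hIU (Or.inl (Or.inr ⟨hx', hx⟩)), That.dbl x.toD 1,
    hIU (Or.inl (Or.inr ⟨hx', hx⟩)), fun h => ?_⟩
  exact absurd (That.eq_dbl_iff.1 h).2 (by decide : (0 : Fin 2) ≠ 1)

/-! ## The flow `X*` -/

lemma coe_Xstar : (Xstar : Set UnaryPairs) = closure (MulAction.orbit AutS2 halfPlanes) := rfl

/-- The half planes are themselves coded by a point, whose orbit is dense in the doubled circle;
conversely the cuts form a closed invariant set containing them. -/
lemma range_halves_eq_Xstar : Set.range halves = (Xstar : Set UnaryPairs) := by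
  rw [coe_Xstar]
  apply Set.Subset.antisymm
  · obtain ⟨t, ht⟩ := isCut_halfPlanes.exists_halves
    rintro _ ⟨s, rfl⟩
    refine closure_mono ?_ (image_closure_subset_closure_image continuous_halves
      ⟨s, dense_setOf_halves_mem_orbit t s, rfl⟩)
    rintro _ ⟨t', ht', rfl⟩
    rwa [← ht]
  · rw [range_halves]
    refine closure_minimal ?_ isClosed_isCut
    rintro _ ⟨g, rfl⟩
    exact isCut_halfPlanes.smul g

/-- The doubled circle is homeomorphic to `X*`. -/
noncomputable def homeoXstar : That ≃ₜ Xstar :=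
  isEmbedding_halves.toHomeomorph.trans (Homeomorph.setCongr range_halves_eq_Xstar)

lemma coe_homeoXstar (t : That) : (homeoXstar t : UnaryPairs) = halves t := rfl

instance : CompactSpace UnaryPairs :=
  inferInstanceAs (CompactSpace ((S2 → Bool) × (S2 → Bool)))

instance : T2Space UnaryPairs :=
  inferInstanceAs (T2Space ((S2 → Bool) × (S2 → Bool)))

instance : CompactSpace Xstar :=
  isCompact_iff_compactSpace.1 (isClosed_closure (s := MulAction.orbit AutS2 halfPlanes)).isCompact

instance : ContinuousSMul AutS2 UnaryPairs where
  continuous_smul := by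
    have eval : Continuous fun p : S2 × (S2 → Bool) => p.2 p.1 :=
      continuous_prod_of_discrete_left.2 fun x => continuous_apply x
    refine Continuous.prodMk (continuous_pi fun x => ?_) (continuous_pi fun x => ?_)
    · exact eval.comp (((continuous_inv_eval x).comp continuous_fst).prodMk
        (continuous_fst.comp continuous_snd))
    · exact eval.comp (((continuous_inv_eval x).comp continuous_fst).prodMk
        (continuous_snd.comp continuous_snd))

instance : ContinuousSMul AutS2 Xstar where
  continuous_smul := by
    refine continuous_induced_rng.2 ?_
    exact continuous_smul.comp (continuous_fst.prodMk (continuous_subtype_val.comp continuous_snd))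

instance : MulAction.IsMinimal AutS2 Xstar where
  dense_orbit T := by
    obtain ⟨t, rfl⟩ := homeoXstar.surjective T
    refine (homeoXstar.surjective.denseRange.dense_image homeoXstar.continuous
      (dense_setOf_halves_mem_orbit t)).mono ?_
    rintro _ ⟨t', ⟨g, hg⟩, rfl⟩
    exact ⟨g, Subtype.ext hg⟩

/-! ## The stabilizer of the pair of half planes -/

instance : Countable S2 :=
  Function.Surjective.countable (f := S2.ofRat) fun ⟨_, q, hq⟩ => ⟨q, Subtype.ext hq⟩

lemma halfPlanes_fst_apply {h : AutS2} (hh : h • halfPlanes = halfPlanes) (x : S2) :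
    halfPlanes.1 (h x) = halfPlanes.1 x := by
  have := congrArg (fun T : UnaryPairs => T.1 (h x)) hh
  rw [← this]
  exact congrArg halfPlanes.1 (RelIso.inv_apply_self h x)

lemma slope_apply_lt {h : AutS2} (hh : h • halfPlanes = halfPlanes) {x y : S2} :
    slope (h x) < slope (h y) ↔ slope x < slope y := by
  rw [← cutLT_halfPlanes, ← cutLT_halfPlanes]
  conv_lhs => rw [← hh, cutLT_smul]
  rw [RelIso.inv_apply_self, RelIso.inv_apply_self]

lemma inv_smul_halfPlanes {h : AutS2} (hh : h • halfPlanes = halfPlanes) :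
    h⁻¹ • halfPlanes = halfPlanes := inv_smul_eq_iff.2 hh.symm

/-- A finite partial map preserving the slopes and the half planes extends to an automorphism which
preserves the half planes. -/
lemma exists_stabilizer_extending (A : Finset S2) (f : S2 → S2)
    (hf : ∀ x ∈ A, ∀ y ∈ A, slope x < slope y → slope (f x) < slope (f y))
    (hcol : ∀ x ∈ A, halfPlanes.1 (f x) = halfPlanes.1 x) :
    ∃ h : AutS2, h • halfPlanes = halfPlanes ∧ ∀ x ∈ A, h x = f x := by
  obtain ⟨g, hg, hgc, hgA⟩ := exists_equiv_extending (ord := slope) (col := halfPlanes.1)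
    slope_injective (fun a b hab c => exists_slope_between hab c) A f hf hcol
  let h : AutS2 := ⟨g, by
    intro x y
    rw [arc_iff_slope, arc_iff_slope, hgc, hgc, hg, hg]⟩
  have hfst : ∀ x, halfPlanes.1 (h⁻¹ x) = halfPlanes.1 x := by
    intro x
    rw [← hgc (h⁻¹ x)]
    exact congrArg halfPlanes.1 (RelIso.apply_inv_self h x)
  refine ⟨h, Prod.ext (funext hfst) (funext fun x => ?_), hgA⟩
  change halfPlanes.2 (h⁻¹ x) = halfPlanes.2 x
  rw [halfPlanes_snd, halfPlanes_snd, hfst]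

/-- If `g` and `g'` move the half planes to partitions that agree on the finite set `A`, then they
agree on `A` up to an automorphism which preserves the half planes. -/
lemma exists_stabilizer_mul (A : Finset S2) (g g' : AutS2)
    (h : ∀ a ∈ A, halfPlanes.1 (g⁻¹ a) = halfPlanes.1 (g'⁻¹ a)) :
    ∃ k : AutS2, k • halfPlanes = halfPlanes ∧ ∀ a ∈ A, (g' * k * g⁻¹) a = a := by
  classical
  -- On `g⁻¹ A` the map `g'⁻¹ g` preserves arcs and, by `h`, half planes; hence it preserves the
  -- order of slopes.
  obtain ⟨k, hk, hkA⟩ := exists_stabilizer_extending (A.image fun a => g⁻¹ a) (fun x => g'⁻¹ (g x)) (by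
      intro x hx y hy
      obtain ⟨a, ha, rfl⟩ := Finset.mem_image.1 hx
      obtain ⟨b, hb, rfl⟩ := Finset.mem_image.1 hy
      rw [RelIso.apply_inv_self, RelIso.apply_inv_self, ← cutLT_halfPlanes, ← cutLT_halfPlanes,
        cutLT, cutLT, h a ha, h b hb]
      split_ifs
      · exact fun h => (g'⁻¹).map_rel_iff.2 ((g⁻¹).map_rel_iff.1 h)
      · exact fun h => (g'⁻¹).map_rel_iff.2 ((g⁻¹).map_rel_iff.1 h)) (by
      intro x hx
      obtain ⟨a, ha, rfl⟩ := Finset.mem_image.1 hx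
      rw [RelIso.apply_inv_self, h a ha])
  refine ⟨k, hk, fun a ha => ?_⟩
  rw [RelIso.mul_apply, RelIso.mul_apply, hkA _ (Finset.mem_image_of_mem (fun a => g⁻¹ a) ha),
    RelIso.apply_inv_self, RelIso.apply_inv_self]

/-! ## Extreme amenability of the stabilizer -/

/-- In a compact flow, the automorphisms that fix a suitable finite set move all points little. -/
lemma exists_finset_forall_fixing {Y : Type*} [UniformSpace Y] [CompactSpace Y] [MulAction AutS2 Y]
    [ContinuousSMul AutS2 Y] {V : Set (Y × Y)} (hV : V ∈ uniformity Y) :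
    ∃ A : Finset S2, ∀ k : AutS2, (∀ a ∈ A, k a = a) → ∀ y : Y, (k • y, y) ∈ V := by
  have h1 : ∀ᶠ k in 𝓝 (1 : AutS2), ∀ y ∈ (Set.univ : Set Y), (k • y, y) ∈ V := by
    refine isCompact_univ.eventually_forall_of_forall_eventually fun y _ => ?_
    have hc : Continuous fun p : AutS2 × Y => (p.1 • p.2, p.2) :=
      continuous_smul.prodMk continuous_snd
    refine hc.continuousAt.eventually ?_
    change ∀ᶠ p in 𝓝 ((1 : AutS2) • y, y), p ∈ V
    rw [one_smul]
    exact nhds_le_uniformity y hV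
  rw [nhds_induced, Filter.eventually_comap, nhds_pi] at h1
  obtain ⟨I, hI, t, ht, hIt⟩ := Filter.mem_pi.1 h1
  refine ⟨hI.toFinset, fun k hk y => hIt (fun x hx => ?_) k rfl y (Set.mem_univ y)⟩
  change k x ∈ t x
  rw [hk x (hI.mem_toFinset.2 hx)]
  exact mem_of_mem_nhds (ht x)

/-- This lets Ramsey's theorem colour sets of integers in place of increasing embeddings of `A`. -/
lemma eqOn_of_image_eq {A : Finset S2} {u u' : S2 → ℕ}
    (hu : ∀ x ∈ A, ∀ y ∈ A, slope x < slope y → u x < u y)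
    (hu' : ∀ x ∈ A, ∀ y ∈ A, slope x < slope y → u' x < u' y) (h : u '' A = u' '' A) :
    ∀ x ∈ A, u x = u' x := by
  let : LinearOrder A :=
    LinearOrder.lift' (fun x => slope x) fun x y h => Subtype.ext (slope_injective h)
  have h1 : StrictMono fun x : A => u x := fun x y hxy => hu x x.2 y y.2 hxy
  have h2 : StrictMono fun x : A => u' x := fun x y hxy => hu' x x.2 y y.2 hxy
  have h3 := (StrictMono.range_inj h1 h2).1 (by
    rw [Set.image_eq_range, Set.image_eq_range] at h
    exact h)
  exact fun x hx => congrFun h3 ⟨x, hx⟩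

/-- A sequence of pairs of vertices of increasing slopes, one in each half plane. -/
lemma exists_increasing_vertices : ∃ z : ℕ → Bool → S2, (∀ n c, halfPlanes.1 (z n c) = c) ∧
    ∀ n m c c', n < m → slope (z n c) < slope (z m c') := by
  have := fun (n : ℕ) (c : Bool) => exists_slope_between (show (n : ℝ) < n + 1 by linarith) c
  choose z hz h1 h2 using this
  refine ⟨z, hz, fun n m c c' hnm => ?_⟩
  have h : ((n + 1 : ℕ) : ℝ) ≤ m := Nat.cast_le.2 hnm
  push_cast at h
  linarith [h2 n c, h1 m c']

/-- Up to a small entourage, `g⁻¹ • y₀` depends only on `g` restricted to a finite set `A`. So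
copies of `A` along an increasing sequence of vertices are coloured by a finite net. Some `g` in the
stabilizer sends all the sets `h⁻¹ A` into a homogeneous part; since `h • g⁻¹ • y₀ = (g * h⁻¹)⁻¹ •
y₀`, all these points are near one point of the net. -/
lemma exists_forall_smul_near {Y : Type*} [UniformSpace Y] [CompactSpace Y] [Nonempty Y]
    [MulAction AutS2 Y] [ContinuousSMul AutS2 Y] {V : Set (Y × Y)} (hV : V ∈ uniformity Y)
    (F : Finset AutS2) (hF : ∀ h ∈ F, h • halfPlanes = halfPlanes) :
    ∃ y : Y, ∀ h ∈ F, (h • y, y) ∈ V := by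
  classical
  obtain ⟨y₀⟩ := ‹Nonempty Y›
  obtain ⟨V₁, hV₁, hsymm₁, hVV₁⟩ := comp_symm_mem_uniformity_sets hV
  obtain ⟨V₂, hV₂, hsymm₂, hVV₂⟩ := comp_symm_mem_uniformity_sets hV₁
  obtain ⟨A, hA⟩ := exists_finset_forall_fixing (Y := Y) hV₂
  obtain ⟨N, hN, hcover⟩ := isCompact_univ.totallyBounded V₂ hV₂
  have hcover' : ∀ y : Y, ∃ n : N, (y, n.1) ∈ V₂ := by
    intro y
    obtain ⟨n, hn, hy⟩ := Set.mem_iUnion₂.1 (hcover (Set.mem_univ y))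
    exact ⟨⟨n, hn⟩, hy⟩
  choose color hcolor using hcover'
  have := hN.to_subtype
  obtain ⟨z, hz, hzlt⟩ := exists_increasing_vertices
  let Mono (B : Finset S2) (u : S2 → ℕ) : Prop :=
    ∀ x ∈ B, ∀ y ∈ B, slope x < slope y → u x < u y
  have hext : ∀ (B : Finset S2) (u : S2 → ℕ), ∃ γ : AutS2, Mono B u →
      γ • halfPlanes = halfPlanes ∧ ∀ x ∈ B, γ x = z (u x) (halfPlanes.1 x) := by
    intro B u
    by_cases hu : Mono B u
    · obtain ⟨γ, h⟩ := exists_stabilizer_extending B (fun x => z (u x) (halfPlanes.1 x))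
        (fun x hx y hy hxy => hzlt _ _ _ _ (hu x hx y hy hxy)) (fun x _ => hz _ _)
      exact ⟨γ, fun _ => h⟩
    · exact ⟨1, fun h => absurd h hu⟩
  choose γ hγ using hext
  -- The fallback colour is harmless: colours are only evaluated at images of `A` under increasing
  -- maps.
  let c (s : Finset ℕ) : N :=
    if h : ∃ u, Mono A u ∧ A.image u = s then color ((γ A h.choose)⁻¹ • y₀) else color y₀
  have hc : ∀ (g : AutS2) (u : S2 → ℕ), Mono A u → (∀ a ∈ A, g a = z (u a) (halfPlanes.1 a)) →
      (g⁻¹ • y₀, (c (A.image u)).1) ∈ V₁ := by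
    intro g u hu hg
    have h : ∃ u', Mono A u' ∧ A.image u' = A.image u := ⟨u, hu, rfl⟩
    obtain ⟨hu', himage⟩ := h.choose_spec
    have heq := eqOn_of_image_eq hu' hu (by
      rw [← Finset.coe_image, ← Finset.coe_image, himage])
    refine hVV₂ ⟨(γ A h.choose)⁻¹ • y₀, ?_, ?_⟩
    · have := hA (g⁻¹ * γ A h.choose) (fun a ha => by
        rw [RelIso.mul_apply, (hγ A _ hu').2 a ha, heq a ha, ← hg a ha, RelIso.inv_apply_self])
        ((γ A h.choose)⁻¹ • y₀)
      rwa [mul_smul, smul_inv_smul] at this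
    · simp only [c, dif_pos h]
      exact hcolor _
  obtain ⟨v, hv, n, hn⟩ := exists_strictMono_forall_card_eq A.card c
  -- The identity is included so that `g⁻¹ • y₀` itself is compared with the net.
  let B : Finset S2 := (insert 1 F).biUnion fun h => A.image fun a => h⁻¹ a
  let rank (x : S2) : ℕ := (B.filter fun y => slope y < slope x).card
  have hrank : ∀ x ∈ B, ∀ y ∈ B, slope x < slope y → rank x < rank y := by
    intro x hx y _ hxy
    refine Finset.card_lt_card (Finset.ssubset_iff_of_subset ?_ |>.2 ⟨x, ?_, ?_⟩)
    · exact fun w hw => Finset.mem_filter.2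
        ⟨(Finset.mem_filter.1 hw).1, (Finset.mem_filter.1 hw).2.trans hxy⟩
    · exact Finset.mem_filter.2 ⟨hx, hxy⟩
    · exact fun h => lt_irrefl _ (Finset.mem_filter.1 h).2
  obtain ⟨hgs, hg⟩ := hγ B (fun x => v (rank x)) fun x hx y hy hxy => hv (hrank x hx y hy hxy)
  set g := γ B fun x => v (rank x)
  have near : ∀ h ∈ insert 1 F, (h • g⁻¹ • y₀, n.1) ∈ V₁ := by
    intro h hhF
    have hh : h • halfPlanes = halfPlanes := by
      rcases Finset.mem_insert.1 hhF with rfl | hh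
      exacts [one_smul _ _, hF h hh]
    have hmem : ∀ a ∈ A, h⁻¹ a ∈ B := fun a ha =>
      Finset.mem_biUnion.2 ⟨h, hhF, Finset.mem_image_of_mem (fun a => h⁻¹ a) ha⟩
    have hu : Mono A fun a => v (rank (h⁻¹ a)) := fun a ha b hb hab =>
      hv (hrank _ (hmem a ha) _ (hmem b hb) ((slope_apply_lt (inv_smul_halfPlanes hh)).2 hab))
    have h1 := hc (g * h⁻¹) _ hu fun a ha => by
      rw [RelIso.mul_apply, hg _ (hmem a ha), halfPlanes_fst_apply (inv_smul_halfPlanes hh)]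
    rw [hn _ _ _] at h1
    · rwa [mul_inv_rev, inv_inv, mul_smul] at h1
    · rw [Finset.coe_image]
      rintro _ ⟨a, -, rfl⟩
      exact ⟨_, rfl⟩
    · refine Finset.card_image_of_injOn fun a ha b hb hab => ?_
      rcases lt_trichotomy (slope a) (slope b) with h' | h' | h'
      · exact absurd hab (hu a ha b hb h').ne
      · exact slope_injective h'
      · exact absurd hab (hu b hb a ha h').ne'
  refine ⟨g⁻¹ • y₀, fun h hh => hVV₁ ⟨n.1, near h (Finset.mem_insert_of_mem hh), ?_⟩⟩
  have h1 := near 1 (Finset.mem_insert_self _ _)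
  rw [one_smul] at h1
  exact SetRel.symm _ h1

/-- The stabilizer of the half planes has a fixed point in every compact Hausdorff flow. -/
theorem exists_fixed_by_stabilizer {Y : Type*} [UniformSpace Y] [CompactSpace Y] [T2Space Y]
    [Nonempty Y] [MulAction AutS2 Y] [ContinuousSMul AutS2 Y] :
    ∃ y : Y, ∀ h : AutS2, h • halfPlanes = halfPlanes → h • y = y := by
  classical
  let ι := {h : AutS2 // h • halfPlanes = halfPlanes} ×
    {V : Set (Y × Y) // V ∈ uniformity Y ∧ IsClosed V}
  -- Being moved within a closed entourage is a closed condition, and finitely many such conditions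
  -- hold together at an almost fixed point.
  obtain ⟨y, hy⟩ := CompactSpace.iInter_nonempty
    (t := fun i : ι => {y : Y | (i.1.1 • y, y) ∈ i.2.1})
    (fun i => i.2.2.2.preimage ((continuous_const_smul i.1.1).prodMk continuous_id)) (by
      intro s
      obtain ⟨y, hy⟩ := exists_forall_smul_near (Y := Y) (V := ⋂ i ∈ s, i.2.1)
        ((Filter.biInter_finset_mem s).2 fun i _ => i.2.2.1) (s.image fun i => i.1.1) (by
          intro h hh
          obtain ⟨i, -, rfl⟩ := Finset.mem_image.1 hh
          exact i.1.2)
      refine ⟨y, Set.mem_iInter₂.2 fun i hi => ?_⟩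
      exact Set.mem_iInter₂.1 (hy i.1.1 (Finset.mem_image_of_mem _ hi)) i hi)
  refine ⟨y, fun h hh => eq_of_uniformity_basis uniformity_hasBasis_closed fun {V} hV => ?_⟩
  exact Set.mem_iInter.1 hy ⟨⟨h, hh⟩, V, hV⟩

/-! ## Universality -/

/-- The half planes as a point of `X*`. -/
noncomputable def basePoint : Xstar :=
  ⟨halfPlanes, subset_closure (MulAction.mem_orbit_self _)⟩

/-- The closure of the orbit of the pair of the half planes and a point fixed by their stabilizer
is the graph of a function. -/
lemma eq_of_mem_closure_range {Y : Type*} [UniformSpace Y] [CompactSpace Y] [T2Space Y]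
    [MulAction AutS2 Y] [ContinuousSMul AutS2 Y] {y : Y}
    (hy : ∀ h : AutS2, h • halfPlanes = halfPlanes → h • y = y) {T : Xstar} {y₁ y₂ : Y}
    (h₁ : (T, y₁) ∈ closure (Set.range fun g : AutS2 => (g • basePoint, g • y)))
    (h₂ : (T, y₂) ∈ closure (Set.range fun g : AutS2 => (g • basePoint, g • y))) : y₁ = y₂ := by
  refine eq_of_uniformity fun {V} hV => ?_
  obtain ⟨V₁, hV₁, hsymm₁, hVV₁⟩ := comp_symm_mem_uniformity_sets hV
  obtain ⟨V₂, hV₂, hsymm₂, hVV₂⟩ := comp_symm_mem_uniformity_sets hV₁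
  obtain ⟨A, hA⟩ := exists_finset_forall_fixing (Y := Y) hV₂
  have hT : ∀ᶠ T' : Xstar in 𝓝 T, ∀ a ∈ A, T'.1.1 a = T.1.1 a := by
    rw [Filter.eventually_all_finset]
    intro a _
    exact ((UnaryPairs.continuous_fst_apply a).comp continuous_subtype_val).continuousAt.eventually
      ((isOpen_discrete {T.1.1 a}).mem_nhds rfl)
  have approx : ∀ y' : Y, (T, y') ∈ closure (Set.range fun g : AutS2 => (g • basePoint, g • y)) →
      ∃ g : AutS2, (∀ a ∈ A, halfPlanes.1 (g⁻¹ a) = T.1.1 a) ∧ (y', g • y) ∈ V₂ := by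
    intro y' h
    obtain ⟨_, ⟨h1, h2⟩, g, rfl⟩ := mem_closure_iff_nhds.1 h _
      (prod_mem_nhds hT (UniformSpace.ball_mem_nhds y' hV₂))
    exact ⟨g, h1, h2⟩
  obtain ⟨g₁, hg₁, hy₁⟩ := approx y₁ h₁
  obtain ⟨g₂, hg₂, hy₂⟩ := approx y₂ h₂
  -- As `k` fixes `y`, the element `g₁ * k * g₂⁻¹` sends `g₂ • y` to `g₁ • y`; it fixes `A`, so
  -- these two points are close.
  obtain ⟨k, hk, hkA⟩ := exists_stabilizer_mul A g₂ g₁ fun a ha => (hg₂ a ha).trans (hg₁ a ha).symm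
  have h := hA _ hkA (g₂ • y)
  rw [mul_smul, mul_smul, inv_smul_smul, hy k hk] at h
  exact hVV₁ ⟨g₂ • y, hVV₂ ⟨g₁ • y, hy₁, h⟩,
    hVV₂ ⟨y₂, SetRel.symm _ hy₂, refl_mem_uniformity hV₂⟩⟩

/-- Every nonempty compact Hausdorff minimal flow is a factor of `X*`. -/
theorem exists_factor_Xstar (Y : Type*) [TopologicalSpace Y] [CompactSpace Y] [T2Space Y]
    [Nonempty Y] [MulAction AutS2 Y] [ContinuousSMul AutS2 Y] [MulAction.IsMinimal AutS2 Y] :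
    ∃ f : Xstar → Y, Continuous f ∧ Function.Surjective f ∧
      ∀ (g : AutS2) (x : Xstar), f (g • x) = g • f x := by
  let : UniformSpace Y := uniformSpaceOfCompactR1
  obtain ⟨y, hy⟩ := exists_fixed_by_stabilizer (Y := Y)
  set W : Set (Xstar × Y) := closure (Set.range fun g : AutS2 => (g • basePoint, g • y)) with hW
  have hWc : IsClosed W := isClosed_closure
  have hex : ∀ T, ∃ y', (T, y') ∈ W := by
    intro T
    have hcl : IsClosed (Prod.fst '' W) := (hWc.isCompact.image continuous_fst).isClosed
    have hmem : T ∈ closure (Prod.fst '' W) := by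
      refine closure_mono ?_ (MulAction.IsMinimal.dense_orbit (M := AutS2) basePoint T)
      rintro _ ⟨g, rfl⟩
      exact ⟨_, subset_closure ⟨g, rfl⟩, rfl⟩
    rw [hcl.closure_eq] at hmem
    obtain ⟨⟨_, y'⟩, h, rfl⟩ := hmem
    exact ⟨y', h⟩
  choose f hf using hex
  have huniq : ∀ {T y'}, (T, y') ∈ W → f T = y' := fun h => eq_of_mem_closure_range hy (hf _) h
  -- Closed graph in a compact product: preimages of closed sets are projections of compact sets.
  have hcont : Continuous f := by
    refine continuous_iff_isClosed.2 fun K hK => ?_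
    have h : f ⁻¹' K = Prod.fst '' (W ∩ Prod.snd ⁻¹' K) := by
      ext T
      constructor
      · exact fun h => ⟨(T, f T), ⟨hf T, h⟩, rfl⟩
      · rintro ⟨⟨_, y'⟩, ⟨h1, h2⟩, rfl⟩
        rw [Set.mem_preimage, huniq h1]
        exact h2
    rw [h]
    exact ((hWc.inter (hK.preimage continuous_snd)).isCompact.image continuous_fst).isClosed
  have hequiv : ∀ (g : AutS2) (x : Xstar), f (g • x) = g • f x := by
    intro g x
    refine huniq (map_mem_closure (f := fun p : Xstar × Y => (g • p.1, g • p.2)) ?_ (hf x) ?_)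
    · exact ((continuous_const_smul g).comp continuous_fst).prodMk
        ((continuous_const_smul g).comp continuous_snd)
    · rintro _ ⟨k, rfl⟩
      exact ⟨g * k, by simp only [mul_smul]⟩
  refine ⟨f, hcont, fun y' => ?_, hequiv⟩
  have hcl : IsClosed (Set.range f) := (isCompact_range hcont).isClosed
  have hmem : y' ∈ closure (Set.range f) := by
    refine closure_mono ?_ (MulAction.IsMinimal.dense_orbit (M := AutS2) (f basePoint) y')
    rintro _ ⟨g, rfl⟩
    exact ⟨_, hequiv g _⟩
  rwa [hcl.closure_eq] at hmem

/-! ### The Cantor space and the final assembly -/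

theorem nonempty_Xstar_homeomorph_nat_bool : Nonempty (Xstar ≃ₜ (ℕ → Bool)) := by
  have : Nonempty S2 := ⟨S2.ofRat 0⟩
  obtain ⟨x, hx⟩ := exists_surjective_nat S2
  have : Nonempty Xstar := ⟨basePoint⟩
  have hev : ∀ n, Continuous fun T : Xstar => T.1.1 (x n) := fun n =>
    (UnaryPairs.continuous_fst_apply (x n)).comp continuous_subtype_val
  refine nonempty_homeomorph_nat_bool (fun n => {T : Xstar | T.1.1 (x n) = true})
    (fun n => (isClopen_discrete {true}).preimage (hev n)) ?_ ?_
  · intro T T' h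
    -- In a cut the second relation is the complement of the first, so the first alone separates
    -- points.
    obtain ⟨t, rfl⟩ := homeoXstar.surjective T
    obtain ⟨t', rfl⟩ := homeoXstar.surjective T'
    have h1 : ∀ y, (halves t).1 y = (halves t').1 y := by
      intro y
      obtain ⟨n, rfl⟩ := hx y
      exact Bool.eq_iff_iff.2 (h n)
    refine Subtype.ext (Prod.ext (funext h1) (funext fun y => ?_))
    change (halves t).2 y = (halves t').2 y
    rw [(isCut_halves t).1, (isCut_halves t').1, h1]
  · intro V hV hne
    have h := That.nontrivial_of_isOpen (hV.preimage homeoXstar.continuous)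
      (hne.preimage homeoXstar.surjective)
    exact (h.image homeoXstar.injective).mono (Set.image_preimage_subset _ _)

theorem isUniversalMinimalFlow_Xstar : IsUniversalMinimalFlow.{u, 0, 0} AutS2 Xstar where
  nonempty := ⟨basePoint⟩
  compactSpace := inferInstance
  t2Space := inferInstance
  continuousSMul := inferInstance
  isMinimal := inferInstance
  universal Y := exists_factor_Xstar Y

end DenseLocalOrder

theorem mainTheorem4 :
    IsUniversalMinimalFlow.{u, 0, 0} DenseLocalOrder.AutS2 DenseLocalOrder.Xstar ∧
    TopologicalSpace.IsTopologicalBasis DenseLocalOrder.That.intervals ∧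
    (∃ φ : DenseLocalOrder.That ≃ₜ DenseLocalOrder.Xstar,
      ∀ t : DenseLocalOrder.That,
        (φ t : DenseLocalOrder.UnaryPairs) = DenseLocalOrder.halves t) ∧
    Nonempty (DenseLocalOrder.Xstar ≃ₜ (ℕ → Bool)) :=
  ⟨DenseLocalOrder.isUniversalMinimalFlow_Xstar, DenseLocalOrder.That.isTopologicalBasis_intervals,
    ⟨DenseLocalOrder.homeoXstar, DenseLocalOrder.coe_homeoXstar⟩,
    DenseLocalOrder.nonempty_Xstar_homeomorph_nat_bool⟩
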